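/- Let $k$ be an algebraically closed field of characteristic zero, $S=k[x_0,\dots,x_n]$, $V^*=S_1$, and let $\mathrm{GL}(V^*)$ act on $S$ by linear substitutions. Let $\prec$ be a monomial order and let $B\subset \mathrm{GL}(V^*)$ be the standard Borel subgroup of all $b$ such that $b.x_i$ involves only variables $x_j\preceq x_i$. Let $I\subset S$ be a saturated homogeneous ideal such that $S/I$ has Hilbert polynomial $P$. Let $m_0$ be the Gotzmann number of $P$, i.e. the least $m_0$ such that for all $m\ge m_0$ every saturated homogeneous ideal of $S$ with Hilbert polynomial $P$ is $m$-regular. For an ideal $J$ write $J^{\mathrm{sat}}=J:\langle x_0,\dots,x_n\rangle^\infty$. (A) Let $m\ge m_0$. Then $d:=\binom{n+m}{m}-P(m)$ is a non-negative integer. Call an index any tuple $\vec\alpha=(\alpha(1),\dots,\alpha(d))$ of exponents $\alpha(i)\in\mathbb N^{n+1}$ of degree $m$ with $\alpha(1)\succ\dots\succ\alpha(d)$, write $\vec\beta\preceq_s\vec\alpha$ if $\beta(i)\preceq\alpha(i)$ for all $i$, put $I_{\vec\alpha}=\langle x^{\alpha(1)},\dots,x^{\alpha(d)}\rangle^{\mathrm{sat}}$,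 and let $$C''_{\vec\alpha}=\{g\in \mathrm{GL}(V^*) : \mathrm{in}_\prec((g.I)_m)=k\langle x^{\alpha(1)},\dots,x^{\alpha(d)}\rangle\}$$ be the preimage of the Schubert cell $C_{\vec\alpha}\subset \mathrm{Gr}_d(S_m)$ (the set of $d$-dimensional $F\subset S_m$ whose initial subspace is spanned by the $x^{\alpha(i)}$) under the orbit map $g\mapsto (g.I)_m$. There are finitely many indices, $\mathrm{GL}(V^*)=\coprod_{\vec\alpha}C''_{\vec\alpha}$, every $C''_{\vec\alpha}$ is Zariski locally closed, and: 1. among the indices with $C''_{\vec\alpha}\neq\emptyset$ there is a greatest one $\vec\alpha^\star$ with respect to $\preceq_s$, and $C''_{\vec\alpha^\star}$ is Zariski open and dense; 2. $g,g'$ lie in the same $C''_{\vec\alpha}$ if and only if $\mathrm{in}_\prec(g.I)^{\mathrm{sat}}=\mathrm{in}_\prec(g'.I)^{\mathrm{sat}}$; moreover, $g\in C''_{\vec\alpha}$ if and only if $\mathrm{in}_\prec(g.I)^{\mathrm{sat}}=I_{\vec\alpha}$; 3. each $C''_{\vec\alpha}$ is $B$-invariant. (B) The initial ideals themselves also decompose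 $\mathrm{GL}(V^*)$: only finitely many ideals $K$ occur as $\mathrm{in}_\prec(g.I)$ with $g\in\mathrm{GL}(V^*)$; for every $K$ the set $\{g : \mathrm{in}_\prec(g.I)=K\}$ is Zariski locally closed and $B$-invariant; and there is exactly one $K$ (the generic initial ideal of $I$) for which this set is Zariski open and dense. -/

import Mathlib

open MvPolynomial

/-! ### Ideals of the polynomial ring `k[x_0, …, x_n]` -/

section Ideals

variable {k : Type*} [Field k] {n : ℕ}

section
attribute [local instance] MvPolynomial.gradedAlgebra

/-- Homogeneous ideals of `k[x_0, …, x_n]` with its standard grading. -/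
def IsHomogeneousIdeal (J : Ideal (MvPolynomial (Fin (n + 1)) k)) : Prop :=
  J.IsHomogeneous (homogeneousSubmodule (Fin (n + 1)) k)

end

/-- The irrelevant ideal `⟨x_0, …, x_n⟩`. -/
noncomputable def irrelevantIdeal (k : Type*) [Field k] (n : ℕ) : Ideal (MvPolynomial (Fin (n + 1)) k) :=
  Ideal.span (Set.range X)

/-- The saturation `J : ⟨x_0, …, x_n⟩^∞`, the union of the increasing chain of the ideals
`J : ⟨x_0, …, x_n⟩^l`. -/
noncomputable def saturationIdeal (J : Ideal (MvPolynomial (Fin (n + 1)) k)) :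
    Ideal (MvPolynomial (Fin (n + 1)) k) :=
  ⨆ l : ℕ, J.colon ((irrelevantIdeal k n ^ l : Ideal (MvPolynomial (Fin (n + 1)) k)) :
    Set (MvPolynomial (Fin (n + 1)) k))

/-- Saturated homogeneous ideals. -/
def IsSaturatedHomogeneous (J : Ideal (MvPolynomial (Fin (n + 1)) k)) : Prop :=
  IsHomogeneousIdeal J ∧ saturationIdeal J = J

/-- The degree `m` part `J_m = J ∩ S_m`, a subspace of `S_m = S^m V^*`
(for `J` saturated, the `m`-th Hilbert point of `J`). -/
noncomputable def degreePart (J : Ideal (MvPolynomial (Fin (n + 1)) k)) (m : ℕ) :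
    Submodule k (MvPolynomial (Fin (n + 1)) k) :=
  J.restrictScalars k ⊓ homogeneousSubmodule (Fin (n + 1)) k m

/-- The Hilbert function `m ↦ dim_k (S/J)_m`; here `(S/J)_m` is the image of `S_m` in `S/J`. -/
noncomputable def hilbertFunction (J : Ideal (MvPolynomial (Fin (n + 1)) k)) (m : ℕ) : ℕ :=
  Module.finrank k
    ((homogeneousSubmodule (Fin (n + 1)) k m).map (Ideal.Quotient.mkₐ k J).toLinearMap)

/-- `P` is the Hilbert polynomial of (the quotient by) `J`. -/
def HasHilbertPolynomial (J : Ideal (MvPolynomial (Fin (n + 1)) k)) (P : Polynomial ℚ) : Prop :=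
  ∀ᶠ m : ℕ in Filter.atTop, (hilbertFunction J m : ℚ) = P.eval (m : ℚ)

/-- The Koszul differential on `⋀ V^* ⊗ S`. The chain `c` stands for
`∑_s e_s ⊗ c s`, where `e_s = e_{s_1} ∧ ⋯ ∧ e_{s_i}` for `s = {s_1 < ⋯ < s_i}`. -/
noncomputable def koszulDiff
    (c : Finset (Fin (n + 1)) → MvPolynomial (Fin (n + 1)) k) :
    Finset (Fin (n + 1)) → MvPolynomial (Fin (n + 1)) k :=
  fun t => ∑ a ∈ tᶜ, (-1) ^ (t.filter (· < a)).card * X a * c (insert a t)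

/-- Castelnuovo–Mumford regularity: `J` is `m`-regular if `Tor_i(J, k)_{i + e} = 0` for all `i` and
all `e > m`. Here `Tor_i(J, k)_{i + e}` is the homology of the Koszul complex
`⋀^{i+1} V^* ⊗ J_{e-1} → ⋀^i V^* ⊗ J_e → ⋀^{i-1} V^* ⊗ J_{e+1}`,
and the condition is written for the direct sum over all `i`. -/
def IsRegularIdeal (J : Ideal (MvPolynomial (Fin (n + 1)) k)) (m : ℕ) : Prop :=
  ∀ e : ℕ, m < e → ∀ c : Finset (Fin (n + 1)) → MvPolynomial (Fin (n + 1)) k,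
    (∀ s, c s ∈ degreePart J e) → koszulDiff c = 0 →
      ∃ b : Finset (Fin (n + 1)) → MvPolynomial (Fin (n + 1)) k,
        (∀ s, b s ∈ degreePart J (e - 1)) ∧ koszulDiff b = c

/-- The Gotzmann number of `P`: the least `m₀` such that, for all `m ≥ m₀`, every saturated
homogeneous ideal of `k[x_0, …, x_n]` with Hilbert polynomial `P` is `m`-regular. -/
noncomputable def gotzmannNumber (k : Type*) [Field k] (n : ℕ) (P : Polynomial ℚ) : ℕ :=
  sInf {m₀ : ℕ | ∀ m : ℕ, m₀ ≤ m → ∀ J : Ideal (MvPolynomial (Fin (n + 1)) k),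
    IsSaturatedHomogeneous J → HasHilbertPolynomial J P → IsRegularIdeal J m}

end Ideals

/-! ### Initial ideals, initial subspaces and Schubert cells -/

section Initial

variable {k : Type*} [Field k] {n : ℕ}

/-- The initial ideal `in_≺(J)`. -/
noncomputable def initialIdeal (ord : MonomialOrder (Fin (n + 1)))
    (J : Ideal (MvPolynomial (Fin (n + 1)) k)) : Ideal (MvPolynomial (Fin (n + 1)) k) :=
  Ideal.span (ord.leadingTerm '' (J : Set (MvPolynomial (Fin (n + 1)) k)))

/-- The initial subspace `in_≺(F)`: the linear span of the initial monomials of the elements of `F`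
(over a field, the leading terms have the same span as the leading monomials). -/
noncomputable def initialSubspace (ord : MonomialOrder (Fin (n + 1)))
    (F : Submodule k (MvPolynomial (Fin (n + 1)) k)) :
    Submodule k (MvPolynomial (Fin (n + 1)) k) :=
  Submodule.span k (ord.leadingTerm '' (F : Set (MvPolynomial (Fin (n + 1)) k)))

/-- Indices: strictly decreasing `d`-tuples `α(1) ≻ ⋯ ≻ α(d)` of exponents of degree `m`. -/
structure SchubertIndex (ord : MonomialOrder (Fin (n + 1))) (m d : ℕ) where
  /-- The exponents. -/
  exps : Fin d → (Fin (n + 1) →₀ ℕ)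
  degree_eq : ∀ i, (exps i).degree = m
  decreasing : ∀ i j, i < j → ord.toSyn (exps j) < ord.toSyn (exps i)

/-- The partial order `⪯_s` on indices (which describes the closures of the Schubert cells):
`α(i) ⪯ β(i)` for all `i`. -/
def SchubertIndex.le {ord : MonomialOrder (Fin (n + 1))} {m d : ℕ}
    (α β : SchubertIndex ord m d) : Prop :=
  ∀ i, ord.toSyn (α.exps i) ≤ ord.toSyn (β.exps i)

/-- The monomials `x^{α(1)}, …, x^{α(d)}`. -/
noncomputable def SchubertIndex.monomials (k : Type*) [Field k]
    {ord : MonomialOrder (Fin (n + 1))} {m d : ℕ} (α : SchubertIndex ord m d) :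
    Set (MvPolynomial (Fin (n + 1)) k) :=
  Set.range fun i => monomial (α.exps i) (1 : k)

/-- The Schubert cell of `α` in the Grassmannian of `d`-dimensional subspaces of `S_m`:
the `F` with `in_≺(F) = k⟨x^{α(1)}, …, x^{α(d)}⟩`. -/
def schubertCell (k : Type*) [Field k] {ord : MonomialOrder (Fin (n + 1))} {m d : ℕ}
    (α : SchubertIndex ord m d) : Set (Submodule k (MvPolynomial (Fin (n + 1)) k)) :=
  {F | F ≤ homogeneousSubmodule (Fin (n + 1)) k m ∧ Module.finrank k F = d ∧
    initialSubspace ord F = Submodule.span k (α.monomials k)}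

/-- The ideal `I_α`: the saturation of `⟨x^{α(1)}, …, x^{α(d)}⟩`. -/
noncomputable def SchubertIndex.ideal (k : Type*) [Field k]
    {ord : MonomialOrder (Fin (n + 1))} {m d : ℕ} (α : SchubertIndex ord m d) :
    Ideal (MvPolynomial (Fin (n + 1)) k) :=
  saturationIdeal (Ideal.span (α.monomials k))

end Initial

/-! ### The general linear group of `V^* = k⟨x_0, …, x_n⟩` -/

section LinearGroup

variable {k : Type*} [Field k] {n : ℕ}

/-- The action of `g ∈ GL(V^*)` on `S = k[x_0, …, x_n]`, where `g` is written as a matrix in the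
basis `x_0, …, x_n` of `V^*`: `g.x_i = ∑_j g_{ji} x_j`. -/
noncomputable def glAct (g : GL (Fin (n + 1)) k) :
    MvPolynomial (Fin (n + 1)) k →ₐ[k] MvPolynomial (Fin (n + 1)) k :=
  aeval fun i => ∑ j, C ((g : Matrix (Fin (n + 1)) (Fin (n + 1)) k) j i) * X j

/-- The ideal `g.J`. -/
noncomputable def glIdeal (g : GL (Fin (n + 1)) k) (J : Ideal (MvPolynomial (Fin (n + 1)) k)) :
    Ideal (MvPolynomial (Fin (n + 1)) k) :=
  J.map (glAct g)

/-- The standard Borel subgroup `B ⊆ GL(V^*)`: in `b.x_i`, no variable `x_j ≻ x_i` occurs. -/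
def standardBorel (k : Type*) [Field k] (ord : MonomialOrder (Fin (n + 1))) :
    Set (GL (Fin (n + 1)) k) :=
  {b | ∀ i j, ord.toSyn (Finsupp.single i 1) < ord.toSyn (Finsupp.single j 1) →
    (b : Matrix (Fin (n + 1)) (Fin (n + 1)) k) j i = 0}

/-- The Zariski topology on (the closed points of) `GL(V^*)`: the sets where a given polynomial in
the matrix entries does not vanish are a basis. -/
@[reducible] def zariskiGL (k : Type*) [Field k] (n : ℕ) : TopologicalSpace (GL (Fin (n + 1)) k) :=
  TopologicalSpace.generateFrom
    {U | ∃ f : MvPolynomial (Fin (n + 1) × Fin (n + 1)) k,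
      U = {g : GL (Fin (n + 1)) k | eval (fun p => (g : Matrix (Fin (n + 1)) (Fin (n + 1)) k) p.1 p.2) f ≠ 0}}

/-- The piece `C''_α = {g ∈ GL(V^*) | [g.I]_m ∈ C_α}`, the preimage of the Schubert cell of `α` under
the orbit map `g ↦ [g.I]_m`. -/
def schubertPiece {ord : MonomialOrder (Fin (n + 1))} {m d : ℕ}
    (I : Ideal (MvPolynomial (Fin (n + 1)) k)) (α : SchubertIndex ord m d) :
    Set (GL (Fin (n + 1)) k) :=
  {g | degreePart (glIdeal g I) m ∈ schubertCell k α}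

/-- The set of `g ∈ GL(V^*)` with `in_≺(g.I) = K`. -/
def initialPiece (ord : MonomialOrder (Fin (n + 1)))
    (I K : Ideal (MvPolynomial (Fin (n + 1)) k)) : Set (GL (Fin (n + 1)) k) :=
  {g | initialIdeal ord (glIdeal g I) = K}

end LinearGroup

/-! Everything is read off from sets of exponents. Let A_e(g) (`movedExponents`) be the set of
leading exponents of (g.I)_e; its size is dim I_e for every g. The number of its elements that are
at least δ is the rank of the coefficients of (g.I)_e at the monomials at least δ
(`finrank_map_coeffsAt`), and a rank can only drop on a Zariski closed set
(`isOpen_le_finrank_map_coeffsAt`). These counts determine A_e(g), so prescribing A_e(g) cuts out a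
locally closed set. Since GL is irreducible, all counts are maximal at once on a dense open set, and
comparing counts is comparing indices under ⪯_s (`SchubertIndex.le_of_ncard_inter_le`). Elements of
B preserve leading exponents (`degree_glAct`), whence the B-invariance.

For (A), let T be the saturation of in(g.I). Taking initial ideals preserves dimensions and
saturating changes only finitely many degrees, so T has Hilbert polynomial P and is m-regular.
Regularity gives T_m the expected dimension, hence T_m = in(g.I)_m, and it makes T_m generate T in
all degrees at least m. Thus T and A_m(g) determine each other
(`mem_schubertPiece_iff_sat_initialIdeal`).

This argument requires that the minimum defining the Gotzmann number is taken over a nonempty set.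
Induction on the number of variables by hyperplane sections gives a degree beyond which every
saturated ideal with prescribed Hilbert function is generated by lower degrees
(`exists_uniform_bound`). The initial ideals are then, in high degrees, among finitely many monomial
ideals, each of which is regular somewhere; regularity passes from in(J) to J because Koszul
exactness does (`KoszulExactAt.of_initialIdeal`). That regularity forces the Hilbert function to
equal P already in degree m is an Euler characteristic computation on Koszul strands.

For (B), the same uniform bound shows that the sets A_e(g) with e ≤ M determine in(g.I) for some M
independent of g, so the initial pieces are finite intersections of the degreewise strata. -/

/-! ### Graded ideals and saturation -/

section GradedIdeals

variable {k : Type*} [Field k] {σ : Type*}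

/-- The degree `e` part of an ideal of a polynomial ring. -/
noncomputable def gradedPart (J : Ideal (MvPolynomial σ k)) (e : ℕ) :
    Submodule k (MvPolynomial σ k) :=
  J.restrictScalars k ⊓ homogeneousSubmodule σ k e

/-- Ideals containing the homogeneous components of their elements. -/
def IsGraded (J : Ideal (MvPolynomial σ k)) : Prop :=
  ∀ f ∈ J, ∀ e, homogeneousComponent e f ∈ J

/-- The saturation with respect to the irrelevant ideal, for any set of variables. -/
noncomputable def sat (J : Ideal (MvPolynomial σ k)) : Ideal (MvPolynomial σ k) :=
  ⨆ l : ℕ, J.colon ((idealOfVars σ k ^ l : Ideal (MvPolynomial σ k)) : Set (MvPolynomial σ k))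

/-- Saturated ideals, for any set of variables. -/
def IsSat (J : Ideal (MvPolynomial σ k)) : Prop :=
  ∀ f, (∀ i, X i * f ∈ J) → f ∈ J

theorem mem_gradedPart {J : Ideal (MvPolynomial σ k)} {e : ℕ} {f : MvPolynomial σ k} :
    f ∈ gradedPart J e ↔ f ∈ J ∧ f.IsHomogeneous e := Iff.rfl

theorem gradedPart_mono {J K : Ideal (MvPolynomial σ k)} (h : J ≤ K) (e : ℕ) :
    gradedPart J e ≤ gradedPart K e := fun _ hf => ⟨h hf.1, hf.2⟩

theorem gradedPart_le (J : Ideal (MvPolynomial σ k)) (e : ℕ) :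
    gradedPart J e ≤ homogeneousSubmodule σ k e := inf_le_right

instance finite_homogeneousSubmodule [Finite σ] (e : ℕ) :
    Module.Finite k (homogeneousSubmodule σ k e) :=
  Module.Finite.iff_fg.mpr (homogeneousSubmodule_fg σ k e)

instance finite_gradedPart [Finite σ] (J : Ideal (MvPolynomial σ k)) (e : ℕ) :
    Module.Finite k (gradedPart J e) :=
  Submodule.finiteDimensional_of_le (gradedPart_le J e)

theorem IsGraded.component_mem {J : Ideal (MvPolynomial σ k)} (hJ : IsGraded J)
    {f : MvPolynomial σ k} (hf : f ∈ J) (e : ℕ) : homogeneousComponent e f ∈ gradedPart J e :=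
  ⟨hJ f hf e, homogeneousComponent_isHomogeneous e f⟩

theorem IsGraded.ext {J K : Ideal (MvPolynomial σ k)} (hJ : IsGraded J) (hK : IsGraded K)
    (h : ∀ e, gradedPart J e = gradedPart K e) : J = K := by
  have key : ∀ {J K : Ideal (MvPolynomial σ k)}, IsGraded J →
      (∀ e, gradedPart J e = gradedPart K e) → J ≤ K := by
    intro J K hJ h f hf
    rw [← sum_homogeneousComponent f]
    refine Ideal.sum_mem _ fun i _ => ?_
    have := hJ.component_mem hf i
    rw [h] at this
    exact this.1
  exact le_antisymm (key hJ h) (key hK fun e => (h e).symm)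

/-- The colon ideals increase with `l`, so their supremum is a union, and powers of the irrelevant
ideal are spanned by monomials. -/
theorem mem_sat {J : Ideal (MvPolynomial σ k)} {f : MvPolynomial σ k} :
    f ∈ sat J ↔ ∃ l : ℕ, ∀ a : σ →₀ ℕ, a.degree = l → f * monomial a 1 ∈ J := by
  have hmono : Monotone fun l : ℕ => J.colon
      ((idealOfVars σ k ^ l : Ideal (MvPolynomial σ k)) : Set (MvPolynomial σ k)) :=
    fun a b hab => Submodule.colon_mono le_rfl (Ideal.pow_le_pow_right hab)
  rw [sat, Submodule.mem_iSup_of_directed _ hmono.directed_le]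
  refine exists_congr fun l => ?_
  rw [pow_idealOfVars_eq_span, Submodule.mem_colon]
  constructor
  · exact fun h a ha => h _ (Ideal.subset_span ⟨a, ha, rfl⟩)
  · intro h s hs
    refine Submodule.span_induction ?_ ?_ ?_ ?_ hs
    · rintro _ ⟨a, ha, rfl⟩; exact h a ha
    · simp
    · intro x y _ _ hx hy; rw [smul_add]; exact J.add_mem hx hy
    · intro a x _ hx; rw [smul_comm]; exact J.mul_mem_left a hx

theorem le_sat (J : Ideal (MvPolynomial σ k)) : J ≤ sat J := fun _ hf =>
  mem_sat.2 ⟨0, fun _ _ => J.mul_mem_right _ hf⟩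

theorem mul_monomial_mem_of_le {J : Ideal (MvPolynomial σ k)} {f : MvPolynomial σ k} {l : ℕ}
    (h : ∀ a : σ →₀ ℕ, a.degree = l → f * monomial a 1 ∈ J) {a : σ →₀ ℕ} (c : k)
    (ha : l ≤ a.degree) : f * monomial a c ∈ J := by
  have h1 : monomial a c ∈ idealOfVars σ k ^ l := by
    by_cases hc : c = 0
    · simp [hc]
    · exact (monomial_mem_pow_idealOfVars_iff l a hc).2 ha
  rw [pow_idealOfVars_eq_span] at h1
  refine Submodule.span_induction ?_ ?_ ?_ ?_ h1
  · rintro _ ⟨a, ha, rfl⟩; exact h a ha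
  · simp
  · intro x y _ _ hx hy; rw [mul_add]; exact J.add_mem hx hy
  · intro a x _ hx; rw [smul_eq_mul, mul_left_comm]; exact J.mul_mem_left a hx

theorem coeff_mul_monomial_ite (f : MvPolynomial σ k) (a d : σ →₀ ℕ) (c : k) :
    coeff d (f * monomial a c) = if a ≤ d then coeff (d - a) f * c else 0 := by
  classical exact coeff_mul_monomial' d a c f

theorem homogeneousComponent_mul_monomial (f : MvPolynomial σ k) (a : σ →₀ ℕ) (c : k) (e : ℕ) :
    homogeneousComponent (e + a.degree) (f * monomial a c) =
      homogeneousComponent e f * monomial a c := by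
  ext d
  rw [coeff_mul_monomial_ite, coeff_homogeneousComponent, coeff_mul_monomial_ite,
    coeff_homogeneousComponent]
  by_cases h : a ≤ d
  · have : d.degree = (d - a).degree + a.degree := by
      rw [← map_add, tsub_add_cancel_of_le h]
    simp [h, this]
  · simp [h]

theorem IsGraded.sat {J : Ideal (MvPolynomial σ k)} (hJ : IsGraded J) : IsGraded (sat J) := by
  intro f hf e
  obtain ⟨l, hl⟩ := mem_sat.1 hf
  refine mem_sat.2 ⟨l, fun a ha => ?_⟩
  rw [← homogeneousComponent_mul_monomial]
  exact hJ _ (hl a ha) _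

theorem isSat_sat [Finite σ] (J : Ideal (MvPolynomial σ k)) : IsSat (sat J) := by
  intro f hf
  choose l hl using fun i => mem_sat.1 (hf i)
  have := Fintype.ofFinite σ
  -- The extra 1 pays for the variable split off below: what remains of the monomial still has
  -- degree at least every `l i`.
  refine mem_sat.2 ⟨(Finset.univ.sup l) + 1, fun a ha => ?_⟩
  obtain ⟨i, hi⟩ : ∃ i, a i ≠ 0 := by
    by_contra! h
    have : a = 0 := Finsupp.ext h
    simp [this] at ha
  have hai : Finsupp.single i 1 ≤ a := by
    rw [Finsupp.single_le_iff]; omega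
  have hdeg : a.degree = (a - Finsupp.single i 1).degree + 1 := by
    conv_lhs => rw [← tsub_add_cancel_of_le hai]
    rw [map_add, Finsupp.degree_single]
  have h1 : monomial a (1 : k) = X i * monomial (a - Finsupp.single i 1) 1 := by
    rw [X, monomial_mul, one_mul, add_tsub_cancel_of_le hai]
  rw [h1, ← mul_assoc, mul_comm f]
  refine mul_monomial_mem_of_le (hl i) 1 ?_
  have := Finset.le_sup (f := l) (Finset.mem_univ i)
  omega

theorem sat_eq_iff [Finite σ] {J : Ideal (MvPolynomial σ k)} : sat J = J ↔ IsSat J := by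
  refine ⟨fun h => h ▸ isSat_sat J, fun h => le_antisymm ?_ (le_sat J)⟩
  intro f hf
  obtain ⟨l, hl⟩ := mem_sat.1 hf
  clear hf
  induction l generalizing f with
  | zero => simpa using hl 0 (by simp)
  | succ l ih =>
    refine h f fun i => ih fun a ha => ?_
    have := hl (Finsupp.single i 1 + a) (by rw [map_add, Finsupp.degree_single, ha, add_comm])
    rwa [show monomial (Finsupp.single i 1 + a) (1 : k) = X i * monomial a 1 by
      rw [X, monomial_mul, one_mul], ← mul_assoc, mul_comm f] at this

/-- Finitely many generators of the saturation are carried into `J` by all monomials of one fixed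
degree. An element of large degree involves only such multiples of them, since the remaining
multiples have too small a degree to contribute. -/
theorem gradedPart_sat_eventually [Finite σ] {J : Ideal (MvPolynomial σ k)} (hJ : IsGraded J) :
    ∀ᶠ e in Filter.atTop, gradedPart (sat J) e = gradedPart J e := by
  obtain ⟨G, hG⟩ : (sat J).FG := IsNoetherian.noetherian _
  have hGs : ∀ g ∈ G, g ∈ sat J := fun g hg => hG ▸ Ideal.subset_span hg
  choose! l hl using fun g hg => mem_sat.1 (hGs g hg)
  filter_upwards [Filter.eventually_ge_atTop (G.sup l + G.sup totalDegree)] with e he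
  refine le_antisymm ?_ (gradedPart_mono (le_sat J) e)
  intro f ⟨hfs, hf⟩
  refine ⟨?_, hf⟩
  change f ∈ J
  rw [← homogeneousComponent_eq_self hf]
  have hfs : f ∈ Submodule.span (MvPolynomial σ k) (G : Set (MvPolynomial σ k)) := by
    change f ∈ Ideal.span _
    rw [hG]; exact hfs
  obtain ⟨c, -, hc⟩ := Submodule.mem_span_finset.1 hfs
  rw [← hc, map_sum]
  refine Ideal.sum_mem _ fun g hg => ?_
  rw [smul_eq_mul, (c g).as_sum, Finset.sum_mul, map_sum]
  refine Ideal.sum_mem _ fun a ha => ?_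
  by_cases h : G.sup l ≤ a.degree
  · refine hJ _ ?_ _
    rw [mul_comm]
    exact mul_monomial_mem_of_le (hl g hg) _ ((Finset.le_sup hg).trans h)
  · rw [homogeneousComponent_eq_zero]
    · exact J.zero_mem
    · have h1 := totalDegree_mul (monomial a (coeff a (c g))) g
      have h2 : (monomial a (coeff a (c g))).totalDegree ≤ a.degree :=
        totalDegree_monomial_le _ _
      have h3 := Finset.le_sup (f := totalDegree) hg
      omega

end GradedIdeals

/-! ### Generic linear forms and hyperplane sections -/

section LinearForms

variable {k : Type*} [Field k] {r : ℕ}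

/-- Over an infinite field a saturated ideal has a linear nonzerodivisor. -/
theorem IsSat.exists_linear_nonzerodivisor [Infinite k]
    {J : Ideal (MvPolynomial (Fin (r + 1)) k)} (hJ : IsSat J) :
    ∃ a : Fin (r + 1) → k, a ≠ 0 ∧ ∀ f, (∑ i, C (a i) * X i) * f ∈ J → f ∈ J := by
  classical
  let S := MvPolynomial (Fin (r + 1)) k
  let L : (Fin (r + 1) → k) →ₗ[k] S :=
    ∑ i, (LinearMap.proj i : (Fin (r + 1) → k) →ₗ[k] k).smulRight (X i : S)
  have hL : ∀ a, L a = ∑ i, C (a i) * X i := by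
    intro a
    simp only [L, LinearMap.sum_apply, LinearMap.smulRight_apply, LinearMap.proj_apply]
    exact Finset.sum_congr rfl fun i _ => MvPolynomial.smul_eq_C_mul _ _
  have hfin := associatedPrimes.finite S (S ⧸ J)
  -- Prime avoidance among linear forms: a vector space over an infinite field is not a finite union
  -- of proper subspaces. The subspace `⊥` is included to force `a ≠ 0`.
  let U : Finset (Subspace k (Fin (r + 1) → k)) :=
    insert ⊥ (hfin.toFinset.image fun p => (p.restrictScalars k).comap L)
  have hU : ⊤ ∉ U := by
    simp only [U, Finset.mem_insert, Finset.mem_image, Set.Finite.mem_toFinset, not_or, not_exists,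
      not_and]
    refine ⟨top_ne_bot, fun p hp htop => ?_⟩
    have hX : ∀ i, (X i : S) ∈ p := by
      intro i
      have : (Pi.single i 1 : Fin (r + 1) → k) ∈ (p.restrictScalars k).comap L := by
        rw [htop]; trivial
      rw [Submodule.mem_comap, hL, Submodule.restrictScalars_mem] at this
      rw [Finset.sum_eq_single i] at this
      · simpa using this
      · intro j _ hj; simp [hj]
      · simp
    rw [AssociatedPrimes.mem_iff, isAssociatedPrime_iff] at hp
    obtain ⟨hprime, x, hx⟩ := hp
    obtain ⟨f, rfl⟩ := Ideal.Quotient.mk_surjective x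
    -- The associated prime `p` annihilates the class of `f`; if it contained every variable,
    -- saturation would put `f` in `J`.
    have hmem : ∀ i, X i * f ∈ J := by
      intro i
      have := hX i
      rw [hx, Submodule.mem_colon_singleton] at this
      rw [← Ideal.Quotient.eq_zero_iff_mem, map_mul]
      exact this
    have hf : Ideal.Quotient.mk J f = 0 := Ideal.Quotient.eq_zero_iff_mem.2 (hJ f hmem)
    apply hprime.ne_top
    rw [hx, hf, Ideal.eq_top_iff_one, Submodule.mem_colon_singleton]
    simp
  obtain ⟨a, ha⟩ := (Set.ne_univ_iff_exists_notMem _).1 (Subspace.biUnion_ne_univ_of_top_notMem hU)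
  simp only [Set.mem_iUnion, not_exists, SetLike.mem_coe] at ha
  refine ⟨a, fun h0 => ha ⊥ (by simp [U]) (by simp [h0]), fun f hf => ?_⟩
  rw [← hL] at hf
  by_contra hfJ
  have hz : L a ∈ ⋃ p ∈ associatedPrimes S (S ⧸ J), (p : Set S) := by
    rw [biUnion_associatedPrimes_eq_zero_divisors]
    refine ⟨Ideal.Quotient.mk J f, fun h => hfJ (Ideal.Quotient.eq_zero_iff_mem.1 h), ?_⟩
    exact Ideal.Quotient.eq_zero_iff_mem.2 hf
  simp only [Set.mem_iUnion] at hz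
  obtain ⟨p, hp, hLp⟩ := hz
  refine ha ((p.restrictScalars k).comap L) ?_ hLp
  simp only [U, Finset.mem_insert, Finset.mem_image, Set.Finite.mem_toFinset]
  exact Or.inr ⟨p, hp, rfl⟩

/-- Restriction of polynomials to a hyperplane, with a section. -/
theorem exists_restriction_to_hyperplane {a : Fin (r + 1) → k} (ha : a ≠ 0) :
    ∃ (p : Fin (r + 1))
      (φ : MvPolynomial (Fin (r + 1)) k →ₐ[k] MvPolynomial (Fin r) k),
      (∀ f e, f.IsHomogeneous e → (φ f).IsHomogeneous e) ∧
      (∀ j, φ (X (p.succAbove j)) = X j) ∧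
      ∀ f, φ f = 0 ↔ ∃ g, f = (∑ i, C (a i) * X i) * g := by
  obtain ⟨p, hp⟩ : ∃ p, a p ≠ 0 := by
    by_contra! h; exact ha (funext h)
  -- The equation of the hyperplane is solved for the variable `X p`, whose coefficient is nonzero.
  let v : Fin (r + 1) → MvPolynomial (Fin r) k :=
    p.insertNth (-(C (a p)⁻¹ * ∑ j, C (a (p.succAbove j)) * X j)) X
  have hvp : v p = -(C (a p)⁻¹ * ∑ j, C (a (p.succAbove j)) * X j) := by simp [v]
  have hvj : ∀ j, v (p.succAbove j) = X j := by intro j; simp [v]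
  have hv : ∀ i, (v i).IsHomogeneous 1 := by
    intro i
    refine Fin.succAboveCases p ?_ ?_ i
    · rw [hvp]
      refine IsHomogeneous.neg (IsHomogeneous.C_mul (IsHomogeneous.sum _ _ _ fun j _ => ?_) _)
      exact isHomogeneous_C_mul_X _ _
    · intro j; rw [hvj]; exact isHomogeneous_X k j
  let φ : MvPolynomial (Fin (r + 1)) k →ₐ[k] MvPolynomial (Fin r) k := aeval v
  let s : MvPolynomial (Fin r) k →ₐ[k] MvPolynomial (Fin (r + 1)) k :=
    aeval fun j => X (p.succAbove j)
  set h : MvPolynomial (Fin (r + 1)) k := ∑ i, C (a i) * X i with hh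
  have hφh : φ h = 0 := by
    simp only [hh, φ, map_add, map_sum, map_mul, aeval_X, aeval_C, Fin.sum_univ_succAbove _ p,
      hvp, hvj, algebraMap_eq]
    rw [mul_neg, ← mul_assoc, ← C_mul, mul_inv_cancel₀ hp]
    simp
  have hker : ∀ f, f - s (φ f) ∈ Ideal.span {h} := by
    intro f
    induction f using MvPolynomial.induction_on with
    | C c => simp [φ, s]
    | add f g hf hg =>
      have : f + g - s (φ (f + g)) = (f - s (φ f)) + (g - s (φ g)) := by
        simp only [map_add]; ring
      rw [this]; exact Ideal.add_mem _ hf hg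
    | mul_X f i hf =>
      have hX : (X i : MvPolynomial (Fin (r + 1)) k) - s (φ (X i)) ∈ Ideal.span {h} := by
        refine Fin.succAboveCases p ?_ ?_ i
        · rw [Ideal.mem_span_singleton]
          refine ⟨C (a p)⁻¹, ?_⟩
          simp only [hh, φ, s, aeval_X, hvp, map_neg, map_mul, map_sum, aeval_C,
            Fin.sum_univ_succAbove _ p, algebraMap_eq]
          rw [add_mul, mul_right_comm, ← C_mul, mul_inv_cancel₀ hp, C_1]
          ring
        · intro j
          simp [φ, s, hvj]
      have : f * X i - s (φ (f * X i)) =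
          (f - s (φ f)) * X i + s (φ f) * (X i - s (φ (X i))) := by
        simp only [map_mul]; ring
      rw [this]
      exact Ideal.add_mem _ (Ideal.mul_mem_right _ _ hf) (Ideal.mul_mem_left _ _ hX)
  refine ⟨p, φ, ?_, ?_, ?_⟩
  · intro f e hf
    have := hf.aeval v hv
    rwa [one_mul] at this
  · intro j; simp [φ, hvj]
  · intro f
    constructor
    · intro hf
      have := hker f
      rw [hf, map_zero, sub_zero, Ideal.mem_span_singleton] at this
      exact this
    · rintro ⟨g, rfl⟩
      rw [map_mul, hφh, zero_mul]

end LinearForms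

/-! ### A uniform bound for saturated ideals with given Hilbert function -/

section UniformBound

variable {k : Type*} [Field k] {r : ℕ}

/-- A degree preserving linear map sends the decomposition into components to the decomposition of
the image. -/
theorem map_homogeneousComponent_of_isHomogeneous {σ τ : Type*}
    {φ : MvPolynomial σ k →ₗ[k] MvPolynomial τ k}
    (hφ : ∀ f e, f.IsHomogeneous e → (φ f).IsHomogeneous e) (f : MvPolynomial σ k) (e : ℕ) :
    homogeneousComponent e (φ f) = φ (homogeneousComponent e f) := by
  conv_lhs => rw [← sum_homogeneousComponent f]
  rw [map_sum, map_sum]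
  have h : ∀ i, homogeneousComponent e (φ (homogeneousComponent i f)) =
      if i = e then φ (homogeneousComponent e f) else 0 := by
    intro i
    have := homogeneousComponent_of_mem (m := e) (hφ _ _ (homogeneousComponent_isHomogeneous i f))
    rw [this]
    split_ifs with h1 h2 h2
    · rw [h1]
    · exact absurd h1.symm h2
    · exact absurd h2.symm h1
    · rfl
  simp only [h, Finset.sum_ite_eq', Finset.mem_range]
  split_ifs with h1
  · rfl
  · rw [homogeneousComponent_eq_zero _ _ (by omega), map_zero]

theorem IsGraded.map_of_surjective {σ τ : Type*} {J : Ideal (MvPolynomial σ k)} (hJ : IsGraded J)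
    {φ : MvPolynomial σ k →ₐ[k] MvPolynomial τ k} (hs : Function.Surjective φ)
    (hφ : ∀ f e, f.IsHomogeneous e → (φ f).IsHomogeneous e) : IsGraded (J.map φ) := by
  intro f hf e
  obtain ⟨g, hg, rfl⟩ := (Ideal.mem_map_iff_of_surjective φ hs).1 hf
  have := map_homogeneousComponent_of_isHomogeneous (φ := φ.toLinearMap) hφ g e
  simp only [AlgHom.toLinearMap_apply] at this
  rw [this]
  exact Ideal.mem_map_of_mem _ (hJ g hg e)

theorem gradedPart_map_of_surjective {σ τ : Type*} {J : Ideal (MvPolynomial σ k)} (hJ : IsGraded J)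
    {φ : MvPolynomial σ k →ₐ[k] MvPolynomial τ k} (hs : Function.Surjective φ)
    (hφ : ∀ f e, f.IsHomogeneous e → (φ f).IsHomogeneous e) (e : ℕ) :
    gradedPart (J.map φ) e = (gradedPart J e).map φ.toLinearMap := by
  ext f
  constructor
  · rintro ⟨hf, hfe⟩
    obtain ⟨g, hg, rfl⟩ := (Ideal.mem_map_iff_of_surjective φ hs).1 hf
    have := map_homogeneousComponent_of_isHomogeneous (φ := φ.toLinearMap) hφ g e
    rw [AlgHom.toLinearMap_apply, homogeneousComponent_eq_self hfe] at this
    exact ⟨_, hJ.component_mem hg e, this.symm⟩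
  · rintro ⟨g, hg, rfl⟩
    exact ⟨Ideal.mem_map_of_mem _ hg.1, hφ _ _ hg.2⟩

theorem isHomogeneous_linear (a : Fin r → k) :
    (∑ i, C (a i) * X i : MvPolynomial (Fin r) k).IsHomogeneous 1 :=
  IsHomogeneous.sum _ _ _ fun _ _ => isHomogeneous_C_mul_X _ _

theorem linear_ne_zero {a : Fin r → k} (ha : a ≠ 0) :
    (∑ i, C (a i) * X i : MvPolynomial (Fin r) k) ≠ 0 := by
  intro h
  apply ha
  funext j
  have := congrArg (coeff (Finsupp.single j 1)) h
  simpa [coeff_sum, coeff_C_mul, coeff_X, Finsupp.single_left_inj] using this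

theorem exists_homogeneous_factor {σ : Type*} {h f g : MvPolynomial σ k} {e : ℕ}
    (hh : h.IsHomogeneous 1)
    (hf : f.IsHomogeneous (e + 1)) (hfg : f = h * g) :
    f = h * homogeneousComponent e g := by
  have h1 : f = homogeneousComponent (e + 1) f := (homogeneousComponent_eq_self hf).symm
  rw [hfg, ← sum_homogeneousComponent g, Finset.mul_sum, map_sum] at h1
  have h2 : ∀ i, homogeneousComponent (e + 1) (h * homogeneousComponent i g) =
      if i = e then h * homogeneousComponent e g else 0 := by
    intro i
    have := homogeneousComponent_of_mem (m := e + 1)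
      (hh.mul (homogeneousComponent_isHomogeneous i g))
    rw [this]
    split_ifs with h1 h2 h2
    · rw [h2]
    · omega
    · omega
    · rfl
  simp only [h2, Finset.sum_ite_eq', Finset.mem_range] at h1
  rw [hfg, ← sum_homogeneousComponent g, Finset.mul_sum, h1]
  split_ifs with h3
  · rw [sum_homogeneousComponent]
  · rw [sum_homogeneousComponent, homogeneousComponent_eq_zero _ _ (by omega), mul_zero]

/-- A hyperplane section by a nonzerodivisor differentiates the Hilbert function. -/
theorem finrank_gradedPart_hyperplane {J : Ideal (MvPolynomial (Fin (r + 1)) k)} (hJ : IsGraded J)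
    {a : Fin (r + 1) → k} (ha : a ≠ 0) (hnzd : ∀ f, (∑ i, C (a i) * X i) * f ∈ J → f ∈ J)
    {φ : MvPolynomial (Fin (r + 1)) k →ₐ[k] MvPolynomial (Fin r) k}
    (hs : Function.Surjective φ) (hφ : ∀ f e, f.IsHomogeneous e → (φ f).IsHomogeneous e)
    (hker : ∀ f, φ f = 0 ↔ ∃ g, f = (∑ i, C (a i) * X i) * g) (e : ℕ) :
    Module.finrank k (gradedPart (J.map φ) (e + 1)) + Module.finrank k (gradedPart J e) =
      Module.finrank k (gradedPart J (e + 1)) := by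
  let ψ := φ.toLinearMap.domRestrict (gradedPart J (e + 1))
  have h1 := LinearMap.finrank_range_add_finrank_ker ψ
  have h2 : LinearMap.range ψ = gradedPart (J.map φ) (e + 1) := by
    rw [gradedPart_map_of_surjective hJ hs hφ, LinearMap.range_domRestrict]
  rw [h2] at h1
  rw [← h1]
  congr 1
  set h : MvPolynomial (Fin (r + 1)) k := ∑ i, C (a i) * X i with hh
  have hh1 : h.IsHomogeneous 1 := isHomogeneous_linear a
  have hh0 : h ≠ 0 := linear_ne_zero ha
  let μ : MvPolynomial (Fin (r + 1)) k →ₗ[k] MvPolynomial (Fin (r + 1)) k := LinearMap.mulLeft k h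
  have hμ : Function.Injective μ := fun x y hxy => mul_left_cancel₀ hh0 hxy
  -- As `h` is a nonzerodivisor modulo `J`, the kernel `J ∩ (h)` of restriction is `h J`, a copy of
  -- `J` shifted by one degree.
  have h3 : (LinearMap.ker ψ).map (gradedPart J (e + 1)).subtype = (gradedPart J e).map μ := by
    ext f
    constructor
    · rintro ⟨⟨f, hf⟩, hf0, rfl⟩
      obtain ⟨g, hg⟩ := (hker f).1 hf0
      have hg' := exists_homogeneous_factor hh1 hf.2 hg
      refine ⟨homogeneousComponent e g, ⟨hnzd _ ?_, homogeneousComponent_isHomogeneous e g⟩, ?_⟩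
      · rw [← hg']; exact hf.1
      · exact hg'.symm
    · rintro ⟨g, hg, rfl⟩
      have hmem : h * g ∈ gradedPart J (e + 1) :=
        ⟨J.mul_mem_left _ hg.1, by simpa [add_comm] using hh1.mul hg.2⟩
      exact ⟨⟨h * g, hmem⟩, (hker _).2 ⟨g, rfl⟩, rfl⟩
  rw [← Submodule.finrank_map_subtype_eq (gradedPart J (e + 1)) (LinearMap.ker ψ), h3]
  exact (LinearEquiv.finrank_eq (Submodule.equivMapOfInjective μ hμ _))

/-- Integer values drop by at least one at each step until the first equality, after which the
sequence is constant and so equal to its eventual value 0. Starting at most at `N`, it can drop at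
most `N` times. -/
theorem eq_zero_of_antitone_of_stationary {D : ℕ → ℤ} {m N : ℕ}
    (hanti : ∀ e, m ≤ e → D (e + 1) ≤ D e)
    (hstat : ∀ e, m ≤ e → D (e + 1) = D e → D (e + 2) = D (e + 1))
    (hev : ∀ᶠ e in Filter.atTop, D e = 0) (hN : D m ≤ N) :
    ∀ e, m + N ≤ e → D e = 0 := by
  obtain ⟨E, hE⟩ := Filter.eventually_atTop.1 hev
  have hmono : ∀ e, m ≤ e → ∀ i, D (e + i) ≤ D e := by
    intro e he i
    induction i with
    | zero => simp
    | succ i ih => exact (hanti (e + i) (by omega)).trans ih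
  have hnonneg : ∀ e, m ≤ e → 0 ≤ D e := fun e he => by
    rw [← hE (e + E) (by omega)]; exact hmono e he E
  have hzero : ∀ e, m ≤ e → D (e + 1) = D e → D e = 0 := by
    intro e he h
    have : ∀ i, D (e + i) = D e ∧ D (e + i + 1) = D (e + i) := by
      intro i
      induction i with
      | zero => exact ⟨rfl, h⟩
      | succ i ih => exact ⟨ih.2.trans ih.1, hstat (e + i) (by omega) ih.2⟩
    rw [← (this E).1]; exact hE _ (by omega)
  have hstep : ∀ i : ℕ, D (m + i) = 0 ∨ D (m + i) ≤ N - i := by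
    intro i
    induction i with
    | zero => right; simpa using hN
    | succ i ih =>
      have h1 := hanti (m + i) (by omega)
      have h2 := hnonneg (m + i + 1) (by omega)
      have h3 := hzero (m + i) (by omega)
      rw [show m + (i + 1) = m + i + 1 by omega]
      push_cast
      by_cases h : D (m + i + 1) = D (m + i)
      · left; rw [h]; exact h3 h
      · rcases ih with ih | ih
        · left; omega
        · right; omega
  intro e he
  obtain ⟨i, rfl⟩ := Nat.exists_eq_add_of_le he
  have h1 : D (m + N) ≤ 0 := by
    rcases hstep N with h | h <;> omega
  have h2 := hmono (m + N) (by omega) i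
  have h3 := hnonneg (m + N + i) (by omega)
  omega

/-- The Hilbert functions of the saturated graded ideals with given eventual Hilbert function are
given by it from a uniform degree on, and the ideals are generated in a uniform degree. -/
theorem exists_uniform_bound [Infinite k] (r : ℕ) : ∀ Q : ℕ → ℤ, ∃ m₀ : ℕ,
    ∀ J : Ideal (MvPolynomial (Fin r) k), IsGraded J → IsSat J →
      (∀ᶠ e in Filter.atTop, (Module.finrank k (gradedPart J e) : ℤ) = Q e) →
      ∀ e, m₀ ≤ e → (Module.finrank k (gradedPart J e) : ℤ) = Q e ∧
        ∀ f ∈ gradedPart J (e + 1), ∃ b : Fin r → MvPolynomial (Fin r) k,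
          (∀ i, b i ∈ gradedPart J e) ∧ f = ∑ i, X i * b i := by
  induction r with
  | zero =>
    intro Q
    have hzero : ∀ (J : Ideal (MvPolynomial (Fin 0) k)) (e : ℕ), gradedPart J (e + 1) = ⊥ := by
      intro J e
      rw [eq_bot_iff]
      rintro f ⟨-, hf⟩
      have h0 : f.IsHomogeneous 0 := isHomogeneous_of_isEmpty _ _ f
      by_contra hne
      have := IsHomogeneous.inj_right hf h0 hne
      omega
    by_cases hQ : ∀ᶠ e in Filter.atTop, (0 : ℤ) = Q e
    · obtain ⟨E, hE⟩ := Filter.eventually_atTop.1 hQ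
      refine ⟨E + 1, fun J _ _ _ e he => ⟨?_, ?_⟩⟩
      · obtain ⟨e, rfl⟩ : ∃ e', e = e' + 1 := ⟨e - 1, by omega⟩
        rw [hzero, finrank_bot, ← hE _ (by omega)]; rfl
      · intro f hf
        rw [hzero] at hf
        exact ⟨fun _ => 0, fun i => i.elim0, by simpa using hf⟩
    -- Positive degree parts vanish without variables, so no ideal meets the hypothesis for such a
    -- `Q`.
    · refine ⟨0, fun J _ _ h => absurd ?_ hQ⟩
      filter_upwards [h, Filter.eventually_ge_atTop 1] with e he he1
      obtain ⟨e, rfl⟩ : ∃ e', e = e' + 1 := ⟨e - 1, by omega⟩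
      rw [← he, hzero, finrank_bot]; rfl
  | succ r ih =>
    intro Q
    -- A hyperplane section replaces the Hilbert function by its first difference. The truncated
    -- subtraction at `e = 0` is harmless, as `Q` matters only in large degrees here.
    obtain ⟨m₁, hm₁⟩ := ih fun e => Q e - Q (e - 1)
    -- This bounds the excess of dim J_{m₁} over `Q m₁` independently of `J`, since J_{m₁} lies in
    -- the full degree `m₁` part.
    let N := ((Module.finrank k (homogeneousSubmodule (Fin (r + 1)) k m₁) : ℤ) - Q m₁).toNat
    refine ⟨m₁ + N + 1, fun J hJ hJs hQ => ?_⟩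
    obtain ⟨a, ha, hnzd⟩ := hJs.exists_linear_nonzerodivisor
    obtain ⟨p, φ, hφ, hφX, hker⟩ := exists_restriction_to_hyperplane ha
    have hsurj : Function.Surjective φ := by
      intro f
      refine ⟨aeval (fun j => X (p.succAbove j)) f, ?_⟩
      have : φ.comp (aeval fun j => X (p.succAbove j)) = AlgHom.id k _ := by
        ext j; simp [hφX]
      exact DFunLike.congr_fun this f
    set J' := J.map φ with hJ'
    have hgr : IsGraded J' := hJ.map_of_surjective hsurj hφ
    have hdim := finrank_gradedPart_hyperplane hJ ha hnzd hsurj hφ hker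
    rw [← hJ'] at hdim
    have hT := hm₁ (sat J') hgr.sat (isSat_sat J') (by
      have hQ1 := (Filter.tendsto_sub_atTop_nat 1).eventually hQ
      filter_upwards [hQ, hQ1, gradedPart_sat_eventually hgr, Filter.eventually_ge_atTop 1]
        with e h1 h2 h3 h4
      obtain ⟨e, rfl⟩ : ∃ e', e = e' + 1 := ⟨e - 1, by omega⟩
      rw [h3, ← h1, ← h2, ← hdim]
      simp)
    have hle : ∀ e, gradedPart J' e ≤ gradedPart (sat J') e := gradedPart_mono (le_sat J')
    let D : ℕ → ℤ := fun e => Module.finrank k (gradedPart J e) - Q e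
    -- The change of the excess `D` measures how far the section `J'` is from its saturation in
    -- degree `e + 1`, so `D` never increases.
    have hstep : ∀ e, m₁ ≤ e → D (e + 1) - D e = Module.finrank k (gradedPart J' (e + 1)) -
        Module.finrank k (gradedPart (sat J') (e + 1)) := by
      intro e he
      have h1 := (hT (e + 1) (by omega)).1
      rw [h1]
      simp only [D, ← hdim, Nat.add_sub_cancel]
      push_cast; ring
    have hfr : ∀ e, m₁ ≤ e → D (e + 1) = D e →
        gradedPart J' (e + 1) = gradedPart (sat J') (e + 1) := by
      intro e he h
      refine Submodule.eq_of_le_of_finrank_eq (hle _) ?_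
      have := hstep e he
      omega
    have hzero : ∀ e, m₁ + N ≤ e → D e = 0 := by
      refine eq_zero_of_antitone_of_stationary ?_ ?_ ?_ ?_
      · intro e he
        have h1 := hstep e he
        have h2 := Submodule.finrank_mono (hle (e + 1))
        omega
      · intro e he h
        have h1 := hfr e he h
        -- Once `J'` agrees with its saturation in one degree it does so in the next, because the
        -- saturation needs no new generators there.
        have h2 : gradedPart J' (e + 2) = gradedPart (sat J') (e + 2) := by
          refine le_antisymm (hle _) fun f hf => ?_
          obtain ⟨b, hb, rfl⟩ := (hT (e + 1) (by omega)).2 f hf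
          refine ⟨Ideal.sum_mem _ fun i _ => Ideal.mul_mem_left _ _ ?_, hf.2⟩
          have := hb i
          rw [← h1] at this
          exact this.1
        have h3 := hstep (e + 1) (by omega)
        rw [h2] at h3
        simp only [sub_self] at h3
        exact sub_eq_zero.1 h3
      · filter_upwards [hQ] with e he
        simp [D, he]
      · have h1 := Submodule.finrank_mono (gradedPart_le J m₁)
        have h2 := Int.self_le_toNat
          ((Module.finrank k (homogeneousSubmodule (Fin (r + 1)) k m₁) : ℤ) - Q m₁)
        simp only [D, N]
        omega
    intro e he
    refine ⟨sub_eq_zero.1 (hzero e (by omega)), fun f hf => ?_⟩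
    have h1 : gradedPart J' e = gradedPart (sat J') e := by
      obtain ⟨e, rfl⟩ : ∃ e', e = e' + 1 := ⟨e - 1, by omega⟩
      exact hfr e (by omega) (by rw [hzero _ (by omega), hzero _ (by omega)])
    have hφf : φ f ∈ gradedPart (sat J') (e + 1) :=
      hle _ ⟨Ideal.mem_map_of_mem _ hf.1, hφ _ _ hf.2⟩
    obtain ⟨b, hb, hfb⟩ := (hT e (by omega)).2 _ hφf
    have hb' : ∀ i, ∃ c ∈ gradedPart J e, φ c = b i := by
      intro i
      have := hb i
      rw [← h1, hJ', gradedPart_map_of_surjective hJ hsurj hφ] at this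
      exact this
    choose c hc hcb using hb'
    -- Generators are lifted from the section. The error restricts to zero, so it is `h` times an
    -- element of `J`, which accounts for the term `a i • g'` in the witness.
    have hφ0 : φ (f - ∑ j, X (p.succAbove j) * c j) = 0 := by
      rw [map_sub, map_sum, hfb]
      simp [hφX, hcb]
    obtain ⟨g, hg⟩ := (hker _).1 hφ0
    have hhom : (f - ∑ j, X (p.succAbove j) * c j).IsHomogeneous (e + 1) := by
      refine hf.2.sub (IsHomogeneous.sum _ _ _ fun j _ => ?_)
      rw [add_comm e]
      exact (isHomogeneous_X k _).mul (hc j).2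
    have hg' := exists_homogeneous_factor (isHomogeneous_linear a) hhom hg
    set g' := homogeneousComponent e g
    have hg'J : g' ∈ gradedPart J e := by
      refine ⟨hnzd _ ?_, homogeneousComponent_isHomogeneous e g⟩
      rw [← hg']
      exact J.sub_mem hf.1 (Ideal.sum_mem _ fun j _ => J.mul_mem_left _ (hc j).1)
    refine ⟨fun i => p.insertNth (α := fun _ => MvPolynomial (Fin (r + 1)) k) 0 c i + a i • g',
      fun i => Submodule.add_mem _ ?_ (Submodule.smul_mem _ _ hg'J), ?_⟩
    · refine Fin.succAboveCases p ?_ ?_ i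
      · simp
      · intro j; simpa using hc j
    · rw [sub_eq_iff_eq_add] at hg'
      rw [hg', Finset.sum_mul]
      simp only [mul_add, Finset.sum_add_distrib]
      refine (add_comm _ _).trans (congrArg₂ _ ?_ ?_)
      · rw [Fin.sum_univ_succAbove _ p]; simp
      · refine Finset.sum_congr rfl fun i _ => ?_
        rw [smul_eq_C_mul]; ring

end UniformBound

/-! ### Leading exponents and ranks of coefficients -/

section LeadingExponents

variable {k : Type*} [Field k] {σ : Type*}

/-- The exponents of the initial monomials of the nonzero elements of a subspace. -/
def leadingExponents (ord : MonomialOrder σ) (F : Submodule k (MvPolynomial σ k)) :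
    Set (σ →₀ ℕ) :=
  {a | ∃ f ∈ F, f ≠ 0 ∧ ord.degree f = a}

/-- The coefficients of a polynomial at finitely many exponents. -/
noncomputable def coeffsAt (k : Type*) [Field k] (T : Finset (σ →₀ ℕ)) :
    MvPolynomial σ k →ₗ[k] (T → k) :=
  LinearMap.pi fun a => lcoeff k a.1

@[simp] theorem coeffsAt_apply (T : Finset (σ →₀ ℕ)) (f : MvPolynomial σ k) (a : T) :
    coeffsAt k T f a = coeff a.1 f := rfl

/-- Triangularity: in a linear relation, only one term contributes at the largest leading exponent
with nonzero coefficient. -/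
theorem linearIndependent_of_degree (ord : MonomialOrder σ) {T : Finset (σ →₀ ℕ)}
    {A : Set (σ →₀ ℕ)} (hA : A ⊆ T) {f : A → MvPolynomial σ k}
    (hf : ∀ a, f a ≠ 0) (hdeg : ∀ a, ord.degree (f a) = a.1) :
    LinearIndependent k fun a => coeffsAt k T (f a) := by
  classical
  rw [linearIndependent_iff']
  intro s c hc
  by_contra! hne
  obtain ⟨i, his, hi⟩ := hne
  obtain ⟨a, ha, hmax⟩ := Finset.exists_max_image (s.filter fun a => c a ≠ 0)
    (fun a => ord.toSyn a.1) ⟨i, by simp [his, hi]⟩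
  rw [Finset.mem_filter] at ha
  have h1 := congrFun hc ⟨a.1, hA a.2⟩
  simp only [Finset.sum_apply, Pi.smul_apply, coeffsAt_apply, smul_eq_mul, Pi.zero_apply] at h1
  rw [Finset.sum_eq_single a] at h1
  · rcases mul_eq_zero.1 h1 with h | h
    · exact ha.2 h
    · rw [← hdeg a] at h
      exact hf a (ord.coeff_degree_eq_zero_iff.1 h)
  · intro b hb hba
    by_cases hcb : c b = 0
    · simp [hcb]
    · have h2 := hmax b (by simp [hb, hcb])
      have h3 : ord.toSyn b.1 < ord.toSyn a.1 :=
        lt_of_le_of_ne h2 fun h => hba (Subtype.ext (ord.toSyn.injective h))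
      rw [ord.coeff_eq_zero_of_lt (by rw [hdeg b]; exact h3), mul_zero]
  · exact fun h => absurd ha.1 h

/-- The rank of a family of coefficients counts the leading exponents in it, if it contains the
leading exponent of each polynomial that it meets. -/
theorem finrank_map_coeffsAt (ord : MonomialOrder σ) (F : Submodule k (MvPolynomial σ k))
    (T : Finset (σ →₀ ℕ))
    (hT : ∀ f ∈ F, ∀ a ∈ T, coeff a f ≠ 0 → ord.degree f ∈ T) :
    Module.finrank k (F.map (coeffsAt k T)) = (leadingExponents ord F ∩ T).ncard := by
  set A := leadingExponents ord F ∩ T with hA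
  have hfin : A.Finite := T.finite_toSet.subset Set.inter_subset_right
  have := hfin.fintype
  have hcard : A.ncard = Fintype.card A := by
    rw [← Nat.card_coe_set_eq, Nat.card_eq_fintype_card]
  rw [hcard]
  refine le_antisymm ?_ ?_
  -- Reading off only the coefficients at leading exponents is injective: a polynomial that is
  -- nonzero on `T` has its leading exponent in `T`, and its coefficient there does not vanish.
  · let R : F.map (coeffsAt k T) →ₗ[k] (A → k) :=
      (LinearMap.pi fun a : A => LinearMap.proj (⟨a.1, a.2.2⟩ : T)).domRestrict _
    have hR : Function.Injective R := by
      rw [← LinearMap.ker_eq_bot, LinearMap.ker_eq_bot']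
      rintro ⟨_, f, hf, rfl⟩ h
      by_contra hne
      obtain ⟨a, ha⟩ : ∃ a : T, coeff a.1 f ≠ 0 := by
        by_contra! h0
        exact hne (Subtype.ext (funext h0))
      have hdeg := hT f hf a.1 a.2 ha
      have hf0 : f ≠ 0 := by rintro rfl; simp at ha
      have := congrFun h ⟨ord.degree f, ⟨f, hf, hf0, rfl⟩, hdeg⟩
      exact hf0 (ord.coeff_degree_eq_zero_iff.1 this)
    simpa using LinearMap.finrank_le_finrank_of_injective hR
  · choose f hfF hf0 hfd using fun a : A => a.2.1
    have hli := linearIndependent_of_degree ord (T := T) Set.inter_subset_right hf0 hfd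
    let v : A → F.map (coeffsAt k T) := fun a => ⟨_, f a, hfF a, rfl⟩
    have hv : LinearIndependent k v :=
      LinearIndependent.of_comp (F.map (coeffsAt k T)).subtype hli
    exact hv.fintype_card_le_finrank

/-- The exponents of degree `e`. -/
noncomputable def exponents (σ : Type*) [Fintype σ] (e : ℕ) : Finset (σ →₀ ℕ) := by
  classical exact Finset.univ.finsuppAntidiag e

theorem mem_exponents [Fintype σ] {e : ℕ} {a : σ →₀ ℕ} : a ∈ exponents σ e ↔ a.degree = e := by
  classical
  simp [exponents, Finset.mem_finsuppAntidiag, Finsupp.degree_eq_sum]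

theorem leadingExponents_subset_exponents [Fintype σ] (ord : MonomialOrder σ)
    {F : Submodule k (MvPolynomial σ k)} {e : ℕ} (hF : F ≤ homogeneousSubmodule σ k e) :
    leadingExponents ord F ⊆ exponents σ e := by
  rintro a ⟨f, hf, h0, rfl⟩
  rw [Finset.mem_coe, mem_exponents]
  exact (hF hf).degree_eq_sum_deg_support (ord.degree_mem_support h0) |>.symm

theorem finrank_eq_ncard_leadingExponents [Fintype σ] (ord : MonomialOrder σ)
    {F : Submodule k (MvPolynomial σ k)} {e : ℕ} (hF : F ≤ homogeneousSubmodule σ k e) :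
    Module.finrank k F = (leadingExponents ord F).ncard := by
  have h1 : Set.InjOn (coeffsAt k (exponents σ e)) F := by
    intro f hf g hg h
    ext a
    by_cases ha : a.degree = e
    · exact congrFun h ⟨a, mem_exponents.2 ha⟩
    · rw [(hF hf).coeff_eq_zero ha, (hF hg).coeff_eq_zero ha]
  have h2 := finrank_map_coeffsAt ord F (exponents σ e) (by
    intro f hf a _ ha
    have hf0 : f ≠ 0 := by rintro rfl; simp at ha
    exact leadingExponents_subset_exponents ord hF ⟨f, hf, hf0, rfl⟩)
  rw [Set.inter_eq_left.2 (leadingExponents_subset_exponents ord hF)] at h2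
  rw [← h2]
  exact (LinearEquiv.finrank_eq (LinearEquiv.ofBijective
    ((coeffsAt k (exponents σ e)).submoduleMap F)
    ⟨fun x y hxy => Subtype.ext (h1 x.2 y.2 (congrArg Subtype.val hxy)),
      (coeffsAt k (exponents σ e)).submoduleMap_surjective F⟩))

theorem span_leadingTerm_eq_restrictSupport (ord : MonomialOrder σ)
    (F : Submodule k (MvPolynomial σ k)) :
    Submodule.span k (ord.leadingTerm '' (F : Set (MvPolynomial σ k))) =
      restrictSupport k (leadingExponents ord F) := by
  rw [restrictSupport_eq_span]
  refine le_antisymm (Submodule.span_le.2 ?_) (Submodule.span_le.2 ?_)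
  · rintro _ ⟨f, hf, rfl⟩
    by_cases h0 : f = 0
    · simp [h0]
    · have : ord.leadingTerm f = ord.leadingCoeff f • monomial (ord.degree f) (1 : k) := by
        rw [smul_monomial, smul_eq_mul, mul_one]; rfl
      rw [this]
      exact Submodule.smul_mem _ _ (Submodule.subset_span ⟨_, ⟨f, hf, h0, rfl⟩, rfl⟩)
  · rintro _ ⟨_, ⟨f, hf, h0, rfl⟩, rfl⟩
    have : monomial (ord.degree f) (1 : k) = (ord.leadingCoeff f)⁻¹ • ord.leadingTerm f := by
      rw [MonomialOrder.leadingTerm, smul_monomial, smul_eq_mul,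
        inv_mul_cancel₀ (ord.leadingCoeff_ne_zero_iff.2 h0)]
    simp only [this]
    exact Submodule.smul_mem _ _ (Submodule.subset_span ⟨f, hf, rfl⟩)

theorem restrictSupport_injective :
    Function.Injective (restrictSupport k : Set (σ →₀ ℕ) → Submodule k (MvPolynomial σ k)) := by
  intro s t h
  ext a
  have := (monomial_mem_restrictSupport (s := s) (m := a) (r := (1 : k)))
  rw [h, monomial_mem_restrictSupport] at this
  simpa using this.symm

theorem finrank_restrictSupport (s : Set (σ →₀ ℕ)) :
    Module.finrank k (restrictSupport k s) = s.ncard := by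
  rw [Module.finrank_eq_nat_card_basis (basisRestrictSupport k s), Nat.card_coe_set_eq]

theorem mem_leadingExponents_of_le (ord : MonomialOrder σ) {J : Ideal (MvPolynomial σ k)}
    {a b : σ →₀ ℕ} (ha : a ∈ leadingExponents ord (J.restrictScalars k)) (hab : a ≤ b) :
    b ∈ leadingExponents ord (J.restrictScalars k) := by
  classical
  obtain ⟨f, hf, h0, rfl⟩ := ha
  have h1 : monomial (b - ord.degree f) (1 : k) ≠ 0 := by simp
  refine ⟨monomial (b - ord.degree f) 1 * f, J.mul_mem_left _ hf, mul_ne_zero h1 h0, ?_⟩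
  rw [ord.degree_mul h1 h0, ord.degree_monomial, if_neg one_ne_zero, tsub_add_cancel_of_le hab]

/-- For a graded ideal, the component of `f` in the degree of its leading exponent lies in the ideal
and keeps that exponent. The monomial order need not be a degree order. -/
theorem leadingExponents_gradedPart (ord : MonomialOrder σ) {J : Ideal (MvPolynomial σ k)}
    (hJ : IsGraded J) (e : ℕ) :
    leadingExponents ord (gradedPart J e) =
      {a ∈ leadingExponents ord (J.restrictScalars k) | a.degree = e} := by
  ext a
  constructor
  · rintro ⟨f, hf, h0, rfl⟩
    exact ⟨⟨f, hf.1, h0, rfl⟩,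
      (IsHomogeneous.degree_eq_sum_deg_support hf.2 (ord.degree_mem_support h0)).symm⟩
  · rintro ⟨⟨f, hf, h0, rfl⟩, he⟩
    have hc : coeff (ord.degree f) (homogeneousComponent e f) = coeff (ord.degree f) f := by
      rw [coeff_homogeneousComponent, if_pos he]
    have h1 : coeff (ord.degree f) (homogeneousComponent e f) ≠ 0 := by
      rw [hc]; exact ord.coeff_degree_ne_zero_iff.2 h0
    refine ⟨homogeneousComponent e f, hJ.component_mem hf e, ?_, ?_⟩
    · intro h; rw [h] at h1; simp at h1
    · apply ord.toSyn.injective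
      refine le_antisymm ?_ (ord.le_degree (mem_support_iff.2 h1))
      rw [ord.degree_le_iff]
      intro b hb
      rw [mem_support_iff, coeff_homogeneousComponent] at hb
      exact ord.le_degree (mem_support_iff.2 fun h => hb (by simp [h]))

end LeadingExponents

/-! ### Initial ideals -/

section InitialIdeals

variable {k : Type*} [Field k] {n : ℕ} (ord : MonomialOrder (Fin (n + 1)))

theorem initialSubspace_eq_restrictSupport
    (F : Submodule k (MvPolynomial (Fin (n + 1)) k)) :
    initialSubspace ord F = restrictSupport k (leadingExponents ord F) :=
  span_leadingTerm_eq_restrictSupport ord F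

theorem mem_initialIdeal {J : Ideal (MvPolynomial (Fin (n + 1)) k)}
    {f : MvPolynomial (Fin (n + 1)) k} :
    f ∈ initialIdeal ord J ↔
      ∀ a ∈ f.support, a ∈ leadingExponents ord (J.restrictScalars k) := by
  have h : initialIdeal ord J = Ideal.span ((fun a => monomial a (1 : k)) ''
      leadingExponents ord (J.restrictScalars k)) := by
    rw [initialIdeal, MonomialOrder.span_leadingTerm_eq_span_monomial']
    congr 1
    ext g
    constructor
    · rintro ⟨f, ⟨hf, h0⟩, rfl⟩
      exact ⟨_, ⟨f, hf, h0, rfl⟩, rfl⟩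
    · rintro ⟨_, ⟨f, hf, h0, rfl⟩, rfl⟩
      exact ⟨f, ⟨hf, h0⟩, rfl⟩
  rw [h, mem_ideal_span_monomial_image]
  refine forall₂_congr fun a _ => ⟨?_, fun ha => ⟨a, ha, le_rfl⟩⟩
  rintro ⟨b, hb, hba⟩
  exact mem_leadingExponents_of_le ord hb hba

theorem isGraded_initialIdeal (J : Ideal (MvPolynomial (Fin (n + 1)) k)) :
    IsGraded (initialIdeal ord J) := by
  intro f hf e
  rw [mem_initialIdeal] at hf ⊢
  intro a ha
  rw [mem_support_iff, coeff_homogeneousComponent] at ha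
  exact hf a (mem_support_iff.2 fun h => ha (by simp [h]))

/-- Converts equalities of initial ideals, degree by degree, into equalities of sets of exponents.
-/
theorem gradedPart_initialIdeal {J : Ideal (MvPolynomial (Fin (n + 1)) k)} (hJ : IsGraded J)
    (e : ℕ) : gradedPart (initialIdeal ord J) e =
      restrictSupport k (leadingExponents ord (gradedPart J e)) := by
  ext f
  rw [mem_gradedPart, mem_initialIdeal, leadingExponents_gradedPart ord hJ,
    mem_restrictSupport_iff]
  constructor
  · rintro ⟨h1, h2⟩ a ha
    exact ⟨h1 a ha, (IsHomogeneous.degree_eq_sum_deg_support h2 ha).symm⟩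
  · intro h
    refine ⟨fun a ha => (h ha).1, ?_⟩
    intro a ha
    have h2 := (h (mem_support_iff.2 ha)).2
    rw [Finsupp.degree_eq_weight_one] at h2
    exact h2

theorem finrank_gradedPart_initialIdeal {J : Ideal (MvPolynomial (Fin (n + 1)) k)}
    (hJ : IsGraded J) (e : ℕ) :
    Module.finrank k (gradedPart (initialIdeal ord J) e) = Module.finrank k (gradedPart J e) := by
  rw [gradedPart_initialIdeal ord hJ, finrank_restrictSupport,
    finrank_eq_ncard_leadingExponents ord (gradedPart_le J e)]

end InitialIdeals

/-! ### The Koszul complex and regularity of a single ideal -/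

section Koszul

variable {k : Type*} [Field k] {n : ℕ}

/-- Exactness of the Koszul complex of `J` at the coefficients of degree `e`. -/
def KoszulExactAt (J : Ideal (MvPolynomial (Fin (n + 1)) k)) (e : ℕ) : Prop :=
  ∀ c : Finset (Fin (n + 1)) → MvPolynomial (Fin (n + 1)) k,
    (∀ s, c s ∈ gradedPart J e) → koszulDiff c = 0 →
      ∃ b : Finset (Fin (n + 1)) → MvPolynomial (Fin (n + 1)) k,
        (∀ s, b s ∈ gradedPart J (e - 1)) ∧ koszulDiff b = c

theorem isRegularIdeal_iff {J : Ideal (MvPolynomial (Fin (n + 1)) k)} {m : ℕ} :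
    IsRegularIdeal J m ↔ ∀ e, m < e → KoszulExactAt J e := Iff.rfl

/-- The sign of `e_a` in `e_a ∧ e_t`. -/
noncomputable def koszulSign (k : Type*) [Field k] (a : Fin (n + 1))
    (t : Finset (Fin (n + 1))) : MvPolynomial (Fin (n + 1)) k :=
  (-1) ^ (t.filter (· < a)).card

theorem koszulSign_mul_self (a : Fin (n + 1)) (t : Finset (Fin (n + 1))) :
    koszulSign k a t * koszulSign k a t = 1 := by
  rw [koszulSign, ← mul_pow]; simp

theorem koszulSign_insert {a b : Fin (n + 1)} {t : Finset (Fin (n + 1))} (ha : a ∉ t) :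
    koszulSign k b (insert a t) = if a < b then -koszulSign k b t else koszulSign k b t := by
  rw [koszulSign, Finset.filter_insert]
  split_ifs with h
  · rw [Finset.card_insert_of_notMem (by simp [ha]), pow_succ, koszulSign]; ring
  · rfl

theorem koszulSign_swap {a b : Fin (n + 1)} (hab : a ≠ b) {t : Finset (Fin (n + 1))}
    (ha : a ∉ t) (hb : b ∉ t) :
    koszulSign k a t * koszulSign k b (insert a t) =
      -(koszulSign k b t * koszulSign k a (insert b t)) := by
  rw [koszulSign_insert ha, koszulSign_insert hb]
  rcases lt_or_gt_of_ne hab with h | h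
  · rw [if_pos h, if_neg h.not_gt]; ring
  · rw [if_neg h.not_gt, if_pos h]; ring

theorem koszulDiff_apply (c : Finset (Fin (n + 1)) → MvPolynomial (Fin (n + 1)) k)
    (t : Finset (Fin (n + 1))) :
    koszulDiff c t = ∑ a ∈ tᶜ, koszulSign k a t * X a * c (insert a t) := rfl

/-- The Koszul differential as a linear map. -/
noncomputable def koszulMap (k : Type*) [Field k] (n : ℕ) :
    (Finset (Fin (n + 1)) → MvPolynomial (Fin (n + 1)) k) →ₗ[MvPolynomial (Fin (n + 1)) k]
      (Finset (Fin (n + 1)) → MvPolynomial (Fin (n + 1)) k) where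
  toFun := koszulDiff
  map_add' b c := by
    ext1 t
    simp only [koszulDiff_apply, Pi.add_apply, mul_add, Finset.sum_add_distrib]
  map_smul' f c := by
    ext1 t
    simp only [koszulDiff_apply, Pi.smul_apply, smul_eq_mul, RingHom.id_apply, Finset.mul_sum]
    exact Finset.sum_congr rfl fun a _ => by ring

theorem koszulMap_apply (c : Finset (Fin (n + 1)) → MvPolynomial (Fin (n + 1)) k) :
    koszulMap k n c = koszulDiff c := rfl

theorem koszulDiff_koszulDiff (c : Finset (Fin (n + 1)) → MvPolynomial (Fin (n + 1)) k) :
    koszulDiff (koszulDiff c) = 0 := by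
  ext1 t
  simp only [koszulDiff_apply, Finset.mul_sum, Pi.zero_apply]
  rw [Finset.sum_sigma']
  refine Finset.sum_involution (fun x _ => ⟨x.2, x.1⟩) ?_ ?_ ?_ ?_
  · rintro ⟨a, b⟩ h
    simp only [Finset.mem_sigma, Finset.mem_compl, Finset.mem_insert, not_or] at h
    have := koszulSign_swap (k := k) (Ne.symm h.2.1) h.1 h.2.2
    simp only [Finset.insert_comm b a]
    linear_combination (X a * X b * c (insert a (insert b t))) * this
  · rintro ⟨a, b⟩ h _ heq
    simp only [Finset.mem_sigma, Finset.mem_compl, Finset.mem_insert, not_or] at h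
    exact h.2.1 (congrArg Sigma.fst heq)
  · rintro ⟨a, b⟩ h
    simp only [Finset.mem_sigma, Finset.mem_compl, Finset.mem_insert, not_or] at h ⊢
    exact ⟨h.2.2, Ne.symm h.2.1, h.1⟩
  · rintro ⟨a, b⟩ _; rfl

/-- The exterior product `e_a ∧ c`. -/
noncomputable def koszulWedge (a : Fin (n + 1))
    (c : Finset (Fin (n + 1)) → MvPolynomial (Fin (n + 1)) k) :
    Finset (Fin (n + 1)) → MvPolynomial (Fin (n + 1)) k :=
  fun t => if a ∈ t then koszulSign k a (t.erase a) * c (t.erase a) else 0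

/-- The wedge with `e_a` is a contracting homotopy for multiplication by `X a`; hence variables
annihilate Koszul homology. -/
theorem koszulDiff_koszulWedge (a : Fin (n + 1))
    (c : Finset (Fin (n + 1)) → MvPolynomial (Fin (n + 1)) k) :
    koszulDiff (koszulWedge a c) + koszulWedge a (koszulDiff c) =
      (X a : MvPolynomial (Fin (n + 1)) k) • c := by
  ext1 t
  rw [Pi.add_apply, Pi.smul_apply, smul_eq_mul, koszulDiff_apply]
  by_cases ha : a ∈ t
  · obtain ⟨u, hau, rfl⟩ : ∃ u, a ∉ u ∧ t = insert a u :=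
      ⟨t.erase a, Finset.notMem_erase a t, (Finset.insert_erase ha).symm⟩
    have hc : uᶜ = insert a (insert a u)ᶜ := by
      ext b; by_cases h : b = a <;> simp [h, hau]
    rw [koszulWedge, if_pos ha, Finset.erase_insert hau, koszulDiff_apply, hc,
      Finset.sum_insert (by simp), mul_add, Finset.mul_sum, add_left_comm,
      ← Finset.sum_add_distrib, Finset.sum_eq_zero, add_zero]
    · linear_combination (X a * c (insert a u)) * koszulSign_mul_self (k := k) a u
    · intro b hb
      simp only [Finset.mem_compl, Finset.mem_insert, not_or] at hb
      have h1 : insert b (insert a u) = insert a (insert b u) := Finset.insert_comm _ _ _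
      have h2 : a ∉ insert b u := by simp [hau, Ne.symm hb.1]
      rw [koszulWedge, if_pos (by simp), h1, Finset.erase_insert h2]
      have h6 : koszulSign k b (insert a u) * koszulSign k a (insert b u) =
          -(koszulSign k a u * koszulSign k b u) := by
        rw [koszulSign_insert hau, koszulSign_insert hb.2]
        rcases lt_or_gt_of_ne hb.1 with h | h
        · rw [if_pos h, if_neg h.not_gt]; ring
        · rw [if_neg h.not_gt, if_pos h]; ring
      linear_combination (X b * c (insert b u)) * h6
  · rw [koszulWedge, if_neg ha, add_zero, Finset.sum_eq_single a]
    · rw [koszulWedge, if_pos (by simp), Finset.erase_insert ha]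
      linear_combination (X a * c t) * koszulSign_mul_self (k := k) a t
    · intro b _ hba
      rw [koszulWedge, if_neg (by simp [ha, Ne.symm hba]), mul_zero]
    · intro h; simp [ha] at h

theorem koszulSign_eq_C (a : Fin (n + 1)) (t : Finset (Fin (n + 1))) :
    ∃ u : k, koszulSign k a t = C u := ⟨(-1) ^ (t.filter (· < a)).card, by simp [koszulSign]⟩

theorem koszulDiff_mem_gradedPart {J : Ideal (MvPolynomial (Fin (n + 1)) k)} {e : ℕ}
    {c : Finset (Fin (n + 1)) → MvPolynomial (Fin (n + 1)) k} (hc : ∀ s, c s ∈ gradedPart J e)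
    (t : Finset (Fin (n + 1))) : koszulDiff c t ∈ gradedPart J (e + 1) := by
  rw [koszulDiff_apply]
  refine Submodule.sum_mem _ fun a _ => ?_
  obtain ⟨u, hu⟩ := koszulSign_eq_C (k := k) a t
  rw [hu, mul_assoc, ← smul_eq_C_mul]
  refine Submodule.smul_mem _ _ ⟨J.mul_mem_left _ (hc _).1, ?_⟩
  rw [add_comm e]
  exact (isHomogeneous_X k a).mul (hc _).2

theorem homogeneousComponent_X_mul {σ : Type*} (e : ℕ) (a : σ) (f : MvPolynomial σ k) :
    homogeneousComponent (e + 1) (X a * f) = X a * homogeneousComponent e f := by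
  have := homogeneousComponent_mul_monomial f (Finsupp.single a 1) 1 e
  rwa [Finsupp.degree_single, ← X, mul_comm, mul_comm (homogeneousComponent e f)] at this

theorem koszulDiff_homogeneousComponent (e : ℕ)
    (c : Finset (Fin (n + 1)) → MvPolynomial (Fin (n + 1)) k) (t : Finset (Fin (n + 1))) :
    koszulDiff (fun s => homogeneousComponent e (c s)) t =
      homogeneousComponent (e + 1) (koszulDiff c t) := by
  rw [koszulDiff_apply, koszulDiff_apply, map_sum]
  refine Finset.sum_congr rfl fun a _ => ?_
  obtain ⟨u, hu⟩ := koszulSign_eq_C (k := k) a t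
  rw [hu, mul_assoc, mul_assoc, homogeneousComponent_C_mul, homogeneousComponent_X_mul]

theorem koszulWedge_mem_gradedPart {J : Ideal (MvPolynomial (Fin (n + 1)) k)} {e : ℕ}
    {c : Finset (Fin (n + 1)) → MvPolynomial (Fin (n + 1)) k} (hc : ∀ s, c s ∈ gradedPart J e)
    (a : Fin (n + 1)) (t : Finset (Fin (n + 1))) : koszulWedge a c t ∈ gradedPart J e := by
  rw [koszulWedge]
  split_ifs
  · obtain ⟨u, hu⟩ := koszulSign_eq_C (k := k) a (t.erase a)
    rw [hu, ← smul_eq_C_mul]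
    exact Submodule.smul_mem _ _ (hc _)
  · exact Submodule.zero_mem _

/-- Every graded ideal is `m`-regular for some `m`. -/
theorem exists_isRegularIdeal {J : Ideal (MvPolynomial (Fin (n + 1)) k)} (hJ : IsGraded J) :
    ∃ m, IsRegularIdeal J m := by
  classical
  -- The cycles with coefficients in `J` form a finitely generated graded module. Above the degrees
  -- of its generators, every cycle is a combination of variables times cycles, hence a boundary.
  let Z : Submodule (MvPolynomial (Fin (n + 1)) k)
      (Finset (Fin (n + 1)) → MvPolynomial (Fin (n + 1)) k) :=
    Submodule.pi Set.univ (fun _ => J) ⊓ LinearMap.ker (koszulMap k n)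
  have hZ : ∀ c, c ∈ Z ↔ (∀ s, c s ∈ J) ∧ koszulDiff c = 0 := by
    intro c
    simp [Z, Submodule.mem_pi, koszulMap_apply]
  have hZc : ∀ c ∈ Z, ∀ e, (fun s => homogeneousComponent e (c s)) ∈ Z := by
    intro c hc e
    rw [hZ] at hc ⊢
    refine ⟨fun s => hJ _ (hc.1 s) e, ?_⟩
    ext1 t
    rw [koszulDiff_homogeneousComponent, hc.2, Pi.zero_apply, map_zero]
  obtain ⟨G, hG⟩ : Z.FG := IsNoetherian.noetherian _
  have hGZ : ∀ z ∈ G, z ∈ Z := fun z hz => hG ▸ Submodule.subset_span hz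
  let Ψ : (Fin (n + 1) → Finset (Fin (n + 1)) → MvPolynomial (Fin (n + 1)) k) →ₗ[
      MvPolynomial (Fin (n + 1)) k] (Finset (Fin (n + 1)) → MvPolynomial (Fin (n + 1)) k) :=
    ∑ a, (X a : MvPolynomial (Fin (n + 1)) k) • LinearMap.proj a
  have hΨ : ∀ z, Ψ z = ∑ a, (X a : MvPolynomial (Fin (n + 1)) k) • z a := by
    intro z; simp [Ψ, LinearMap.sum_apply]
  -- `W` is the product of the irrelevant ideal with `Z`.
  let W := (Submodule.pi Set.univ (fun _ => Z)).map Ψ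
  have hWX : ∀ a, ∀ z ∈ Z, (X a : MvPolynomial (Fin (n + 1)) k) • z ∈ W := by
    intro a z hz
    refine ⟨Pi.single a z, ?_, ?_⟩
    · rw [SetLike.mem_coe, Submodule.mem_pi]
      intro b _
      by_cases h : b = a
      · subst h; simpa using hz
      · simp [h]
    · rw [hΨ, Finset.sum_eq_single a]
      · simp
      · intro b _ h; simp [h]
      · simp
  refine ⟨G.sup fun z => Finset.univ.sup fun s => (z s).totalDegree, fun e he c hc hc0 => ?_⟩
  obtain ⟨e, rfl⟩ : ∃ e', e = e' + 1 := ⟨e - 1, by omega⟩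
  have hcc : (fun s => homogeneousComponent (e + 1) (c s)) = c :=
    funext fun s => homogeneousComponent_eq_self (hc s).2
  have hgen : ∀ z ∈ G, ∀ f : MvPolynomial (Fin (n + 1)) k,
      (fun s => homogeneousComponent (e + 1) (f * z s)) ∈ W := by
    intro z hz f
    induction f using MvPolynomial.induction_on with
    | C u =>
      have : (fun s => homogeneousComponent (e + 1) (C u * z s)) = 0 := by
        ext1 s
        rw [homogeneousComponent_C_mul, homogeneousComponent_eq_zero, mul_zero, Pi.zero_apply]
        have h1 := Finset.le_sup (f := fun z : Finset (Fin (n + 1)) → MvPolynomial (Fin (n + 1)) k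
          => Finset.univ.sup fun s => (z s).totalDegree) hz
        have h2 := Finset.le_sup (f := fun s => (z s).totalDegree) (Finset.mem_univ s)
        exact (h2.trans h1).trans_lt he
      rw [this]; exact W.zero_mem
    | add f g hf hg =>
      convert W.add_mem hf hg using 1
      ext1 s
      simp [add_mul]
    | mul_X f a _ =>
      have h1 := hWX a _ (hZc _ (Z.smul_mem f (hGZ z hz)) e)
      convert h1 using 1
      ext1 s
      rw [Pi.smul_apply, smul_eq_mul, ← homogeneousComponent_X_mul, Pi.smul_apply, smul_eq_mul]
      congr 1; ring
  have hcW : c ∈ W := by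
    have hcZ : c ∈ Submodule.span (MvPolynomial (Fin (n + 1)) k) (G : Set (Finset (Fin (n + 1)) →
        MvPolynomial (Fin (n + 1)) k)) := by
      rw [hG, hZ]; exact ⟨fun s => (hc s).1, hc0⟩
    obtain ⟨f, -, hf⟩ := Submodule.mem_span_finset.1 hcZ
    have : c = ∑ z ∈ G, fun s => homogeneousComponent (e + 1) (f z * z s) := by
      rw [← hcc, ← hf]
      ext1 s
      simp [Finset.sum_apply]
    rw [this]
    exact W.sum_mem fun z hz => hgen z hz (f z)
  obtain ⟨z, hz, hzc⟩ := hcW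
  rw [SetLike.mem_coe, Submodule.mem_pi] at hz
  let z' : Fin (n + 1) → Finset (Fin (n + 1)) → MvPolynomial (Fin (n + 1)) k :=
    fun a s => homogeneousComponent e (z a s)
  have hz'Z : ∀ a, z' a ∈ Z := fun a => hZc _ (hz a trivial) e
  have hz'J : ∀ a s, z' a s ∈ gradedPart J e := fun a s =>
    ⟨((hZ _).1 (hz'Z a)).1 s, homogeneousComponent_isHomogeneous _ _⟩
  have hcz : c = ∑ a, (X a : MvPolynomial (Fin (n + 1)) k) • z' a := by
    rw [← hcc, ← hzc, hΨ]
    ext1 s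
    simp [z', Finset.sum_apply, homogeneousComponent_X_mul]
  -- Writing `c` as the sum of the `X a • z' a` with cycles `z' a`, the homotopy exhibits it as the
  -- boundary of the sum of the `e_a ∧ z' a`.
  refine ⟨∑ a, koszulWedge a (z' a), fun s => ?_, ?_⟩
  · rw [Finset.sum_apply]
    exact Submodule.sum_mem _ fun a _ => koszulWedge_mem_gradedPart (hz'J a) a s
  · rw [← koszulMap_apply, map_sum, hcz]
    refine Finset.sum_congr rfl fun a _ => ?_
    rw [koszulMap_apply, ← koszulDiff_koszulWedge, ((hZ _).1 (hz'Z a)).2]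
    have : koszulWedge a (0 : Finset (Fin (n + 1)) → MvPolynomial (Fin (n + 1)) k) = 0 := by
      ext1 t; simp [koszulWedge]
    rw [this, add_zero]

end Koszul

/-! ### Koszul exactness passes from the initial ideal to the ideal -/

section Semicontinuity

variable {k : Type*} [Field k] {n : ℕ}

/-- The multidegree of the basis vector `e_s` of the exterior algebra. -/
noncomputable def wedgeExponent (s : Finset (Fin (n + 1))) : Fin (n + 1) →₀ ℕ :=
  ∑ i ∈ s, Finsupp.single i 1

theorem wedgeExponent_insert {a : Fin (n + 1)} {s : Finset (Fin (n + 1))} (ha : a ∉ s) :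
    wedgeExponent (insert a s) = Finsupp.single a 1 + wedgeExponent s :=
  Finset.sum_insert ha

/-- The part of multidegree `δ` of a Koszul chain. -/
noncomputable def multidegreePart (δ : Fin (n + 1) →₀ ℕ)
    (c : Finset (Fin (n + 1)) → MvPolynomial (Fin (n + 1)) k) :
    Finset (Fin (n + 1)) → MvPolynomial (Fin (n + 1)) k :=
  fun s => if wedgeExponent s ≤ δ then
    monomial (δ - wedgeExponent s) (coeff (δ - wedgeExponent s) (c s)) else 0

theorem coeff_multidegreePart (δ : Fin (n + 1) →₀ ℕ)
    (c : Finset (Fin (n + 1)) → MvPolynomial (Fin (n + 1)) k) (s : Finset (Fin (n + 1)))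
    (a : Fin (n + 1) →₀ ℕ) :
    coeff a (multidegreePart δ c s) = if a + wedgeExponent s = δ then coeff a (c s) else 0 := by
  classical
  rw [multidegreePart]
  by_cases h : a + wedgeExponent s = δ
  · have h1 : wedgeExponent s ≤ δ := h ▸ le_add_self
    have h2 : δ - wedgeExponent s = a := by rw [← h, add_tsub_cancel_right]
    rw [if_pos h1, if_pos h, h2, coeff_monomial, if_pos rfl]
  · rw [if_neg h]
    split_ifs with h1
    · rw [coeff_monomial, if_neg]
      rintro rfl
      exact h (tsub_add_cancel_of_le h1)
    · rw [coeff_zero]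

/-- The Koszul complex is graded by multidegree, with `e_s` placed in degree `wedgeExponent s`. This
lets the monomial order compare terms in different slots. -/
theorem multidegreePart_koszulDiff (δ : Fin (n + 1) →₀ ℕ)
    (c : Finset (Fin (n + 1)) → MvPolynomial (Fin (n + 1)) k) :
    koszulDiff (multidegreePart δ c) = multidegreePart δ (koszulDiff c) := by
  classical
  ext1 t
  ext a
  rw [coeff_multidegreePart, koszulDiff_apply, koszulDiff_apply, coeff_sum, coeff_sum,
    ← Finset.sum_filter_add_sum_filter_not tᶜ (fun _ => True)]
  simp only [Finset.filter_true, not_true_eq_false, Finset.filter_false, Finset.sum_empty, add_zero]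
  have key : ∀ i ∈ tᶜ, coeff a (koszulSign k i t * X i * multidegreePart δ c (insert i t)) =
      if a + wedgeExponent t = δ then coeff a (koszulSign k i t * X i * c (insert i t)) else 0 := by
    intro i hi
    obtain ⟨u, hu⟩ := koszulSign_eq_C (k := k) i t
    rw [hu, mul_assoc, mul_assoc, coeff_C_mul, coeff_C_mul, coeff_X_mul', coeff_X_mul']
    by_cases h : i ∈ a.support
    · rw [if_pos h, if_pos h, coeff_multidegreePart,
        wedgeExponent_insert (Finset.mem_compl.1 hi)]
      have h1 : a - Finsupp.single i 1 + (Finsupp.single i 1 + wedgeExponent t) =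
          a + wedgeExponent t := by
        rw [← add_assoc, tsub_add_cancel_of_le]
        rw [Finsupp.single_le_iff]
        have := Finsupp.mem_support_iff.1 h
        omega
      rw [h1]
      split_ifs <;> simp
    · rw [if_neg h, if_neg h]; simp
  rw [Finset.sum_congr rfl key]
  split_ifs <;> simp

theorem koszulDiff_support_le {ord : MonomialOrder (Fin (n + 1))} {δ : ord.syn}
    {b : Finset (Fin (n + 1)) → MvPolynomial (Fin (n + 1)) k}
    (hb : ∀ s, ∀ a ∈ (b s).support, ord.toSyn (a + wedgeExponent s) ≤ δ) :
    ∀ s, ∀ a ∈ (koszulDiff b s).support, ord.toSyn (a + wedgeExponent s) ≤ δ := by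
  intro s a ha
  have h1 : multidegreePart (a + wedgeExponent s) b ≠ 0 := by
    intro h
    have h2 := congrArg (fun c => coeff a (c s)) (multidegreePart_koszulDiff (a + wedgeExponent s) b)
    simp only [h, coeff_multidegreePart, if_true] at h2
    rw [← koszulMap_apply, map_zero, Pi.zero_apply, coeff_zero] at h2
    exact mem_support_iff.1 ha h2.symm
  obtain ⟨t, ht⟩ := Function.ne_iff.1 h1
  obtain ⟨a', ha'⟩ := ne_zero_iff.1 ht
  rw [coeff_multidegreePart] at ha'
  obtain ⟨h2, h3⟩ := ite_ne_right_iff.1 ha'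
  rw [← h2]
  exact hb t a' (mem_support_iff.2 h3)

/-- Exactness of the Koszul complex passes from the initial ideal to the ideal. -/
theorem KoszulExactAt.of_initialIdeal (ord : MonomialOrder (Fin (n + 1)))
    {J : Ideal (MvPolynomial (Fin (n + 1)) k)} (hJ : IsGraded J) {e : ℕ}
    (h : KoszulExactAt (initialIdeal ord J) (e + 1)) : KoszulExactAt J (e + 1) := by
  classical
  -- Well-founded induction on a bound `δ` for the multidegrees of the cycle: its part in
  -- multidegree `δ` is a cycle of the initial ideal, hence a boundary there, and lifting the
  -- bounding chain to `J` removes that part.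
  have key : ∀ δ : ord.syn, ∀ c : Finset (Fin (n + 1)) → MvPolynomial (Fin (n + 1)) k,
      (∀ s, c s ∈ gradedPart J (e + 1)) → koszulDiff c = 0 →
      (∀ s, ∀ a ∈ (c s).support, ord.toSyn (a + wedgeExponent s) ≤ δ) →
      ∃ b : Finset (Fin (n + 1)) → MvPolynomial (Fin (n + 1)) k,
        (∀ s, b s ∈ gradedPart J e) ∧ koszulDiff b = c := by
    intro δ
    induction δ using WellFoundedLT.induction with
    | ind δ ih =>
    intro c hc hc0 hδ
    obtain ⟨δ, rfl⟩ := ord.toSyn.surjective δ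
    obtain ⟨b', hb', hbc'⟩ := h (multidegreePart δ c) (by
      intro s
      rw [gradedPart_initialIdeal ord hJ, mem_restrictSupport_iff]
      intro a ha
      rw [Finset.mem_coe, mem_support_iff, coeff_multidegreePart] at ha
      obtain ⟨h1, h2⟩ := ite_ne_right_iff.1 ha
      refine ⟨c s, hc s, by rintro h3; rw [h3, coeff_zero] at h2; exact h2 rfl, ?_⟩
      apply ord.toSyn.injective
      refine le_antisymm (ord.degree_le_iff.2 fun b hb => ?_)
        (ord.le_degree (mem_support_iff.2 h2))
      have := hδ s b hb
      rw [← h1, map_add, map_add] at this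
      exact le_of_add_le_add_right this) (by
      rw [multidegreePart_koszulDiff, hc0]
      ext1 s; ext a
      rw [coeff_multidegreePart]; simp)
    -- Multidegree `δ` allows a single exponent in slot `s`. If `b' s` has a nonzero coefficient
    -- there, that exponent is a leading exponent of J_e, so a multiple of an element of J_e matches
    -- the coefficient with all other terms below.
    have hlift : ∀ s, ∃ f ∈ gradedPart J e,
        (∀ a ∈ f.support, ord.toSyn (a + wedgeExponent s) ≤ ord.toSyn δ) ∧
        ∀ a, a + wedgeExponent s = δ → coeff a f = coeff a (b' s) := by
      intro s
      by_cases h0 : wedgeExponent s ≤ δ ∧ coeff (δ - wedgeExponent s) (b' s) ≠ 0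
      · have hmem := hb' s
        rw [gradedPart_initialIdeal ord hJ, mem_restrictSupport_iff] at hmem
        obtain ⟨f, hf, hf0, hdeg⟩ := hmem (mem_support_iff.2 h0.2)
        refine ⟨(coeff (δ - wedgeExponent s) (b' s) * (ord.leadingCoeff f)⁻¹) • f,
          Submodule.smul_mem _ _ hf, ?_, ?_⟩
        · intro a ha
          have h1 := ord.le_degree (support_smul ha)
          rw [hdeg] at h1
          rw [← tsub_add_cancel_of_le h0.1, map_add, map_add]
          exact add_le_add_left h1 _
        · intro a ha
          obtain rfl : a = δ - wedgeExponent s := by rw [← ha, add_tsub_cancel_right]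
          rw [coeff_smul, smul_eq_mul, MonomialOrder.leadingCoeff, hdeg, mul_assoc,
            inv_mul_cancel₀, mul_one]
          rw [← hdeg]; exact ord.coeff_degree_ne_zero_iff.2 hf0
      · refine ⟨0, Submodule.zero_mem _, by simp, fun a ha => ?_⟩
        have h1 : wedgeExponent s ≤ δ := ha ▸ le_add_self
        have h2 : δ - wedgeExponent s = a := by rw [← ha, add_tsub_cancel_right]
        rw [h2] at h0
        have : coeff a (b' s) = 0 := by
          by_contra h3; exact h0 ⟨h1, h3⟩
        rw [this, coeff_zero]
    choose b hb hbδ hbc using hlift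
    have hpart : multidegreePart δ b = multidegreePart δ b' := by
      ext1 s; ext a
      rw [coeff_multidegreePart, coeff_multidegreePart]
      split_ifs with h1
      · exact hbc s a h1
      · rfl
    set d := c - koszulDiff b with hd
    have hdJ : ∀ s, d s ∈ gradedPart J (e + 1) := fun s =>
      Submodule.sub_mem _ (hc s) (koszulDiff_mem_gradedPart hb s)
    have hd0 : koszulDiff d = 0 := by
      rw [hd, ← koszulMap_apply, map_sub, koszulMap_apply, koszulMap_apply, hc0,
        koszulDiff_koszulDiff, sub_zero]
    have hdδ : ∀ s, ∀ a ∈ (d s).support, ord.toSyn (a + wedgeExponent s) < ord.toSyn δ := by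
      intro s a ha
      refine lt_of_le_of_ne ?_ fun heq => ?_
      · have h1 := support_sub _ (c s) (koszulDiff b s) ha
        rcases Finset.mem_union.1 h1 with h1 | h1
        · exact hδ s a h1
        · exact koszulDiff_support_le hbδ s a h1
      · have h1 := ord.toSyn.injective heq
        have h3 : multidegreePart δ (koszulDiff b) = multidegreePart δ c := by
          rw [← multidegreePart_koszulDiff, hpart, multidegreePart_koszulDiff, hbc']
          ext1 s; ext a
          rw [coeff_multidegreePart, coeff_multidegreePart]
          split_ifs <;> rfl
        have h4 := congrArg (fun c => coeff a (c s)) h3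
        simp only [coeff_multidegreePart, if_pos h1] at h4
        rw [mem_support_iff, hd, Pi.sub_apply, coeff_sub, h4, sub_self] at ha
        exact ha rfl
    by_cases hd00 : d = 0
    · exact ⟨b, hb, (sub_eq_zero.1 hd00).symm⟩
    · let T : Finset ((_ : Finset (Fin (n + 1))) × (Fin (n + 1) →₀ ℕ)) :=
        Finset.univ.sigma fun s => (d s).support
      have hT : T.Nonempty := by
        obtain ⟨s, hs⟩ := Function.ne_iff.1 hd00
        obtain ⟨a, ha⟩ := support_nonempty.2 hs
        exact ⟨⟨s, a⟩, by simpa [T] using ha⟩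
      obtain ⟨⟨s, a⟩, hsa, hmax⟩ := Finset.exists_max_image T
        (fun x => ord.toSyn (x.2 + wedgeExponent x.1)) hT
      obtain ⟨b₂, hb₂, hbd⟩ := ih _ (hdδ s a (by simpa [T] using hsa)) d hdJ hd0
        fun t a' ha' => hmax ⟨t, a'⟩ (by simpa [T] using ha')
      refine ⟨b + b₂, fun s => Submodule.add_mem _ (hb s) (hb₂ s), ?_⟩
      rw [← koszulMap_apply, map_add, koszulMap_apply, koszulMap_apply, hbd, hd]
      abel
  intro c hc hc0
  let T : Finset ((_ : Finset (Fin (n + 1))) × (Fin (n + 1) →₀ ℕ)) :=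
    Finset.univ.sigma fun s => (c s).support
  refine key (T.sup fun x => ord.toSyn (x.2 + wedgeExponent x.1)) c hc hc0 fun s a ha => ?_
  exact Finset.le_sup (f := fun x : (_ : Finset (Fin (n + 1))) × (Fin (n + 1) →₀ ℕ) =>
    ord.toSyn (x.2 + wedgeExponent x.1)) (b := ⟨s, a⟩) (by simpa [T] using ha)

end Semicontinuity

/-! ### Uniform regularity of saturated ideals -/

section UniformRegularity

variable {k : Type*} [Field k] {n : ℕ}

theorem isGraded_span_monomial {σ : Type*} (A : Set (σ →₀ ℕ)) :
    IsGraded (Ideal.span ((fun a => monomial a (1 : k)) '' A)) := by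
  intro f hf e
  rw [mem_ideal_span_monomial_image] at hf ⊢
  intro a ha
  rw [mem_support_iff, coeff_homogeneousComponent] at ha
  exact hf a (mem_support_iff.2 fun h => ha (by simp [h]))

/-- From the uniform degree of `exists_uniform_bound` on, the initial ideal of a graded ideal
with the Hilbert function `Q` agrees with its saturation and needs no further generators. -/
theorem gradedPart_sat_initialIdeal (ord : MonomialOrder (Fin (n + 1))) {Q : ℕ → ℤ} {m₀ : ℕ}
    (hm₀ : ∀ J : Ideal (MvPolynomial (Fin (n + 1)) k), IsGraded J → IsSat J →
      (∀ᶠ e in Filter.atTop, (Module.finrank k (gradedPart J e) : ℤ) = Q e) →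
      ∀ e, m₀ ≤ e → (Module.finrank k (gradedPart J e) : ℤ) = Q e ∧
        ∀ f ∈ gradedPart J (e + 1), ∃ b : Fin (n + 1) → MvPolynomial (Fin (n + 1)) k,
          (∀ i, b i ∈ gradedPart J e) ∧ f = ∑ i, X i * b i)
    {J : Ideal (MvPolynomial (Fin (n + 1)) k)} (hJ : IsGraded J)
    (hQ : ∀ e, m₀ ≤ e → (Module.finrank k (gradedPart J e) : ℤ) = Q e)
    {e : ℕ} (he : m₀ ≤ e) :
    gradedPart (sat (initialIdeal ord J)) e = gradedPart (initialIdeal ord J) e ∧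
      ∀ f ∈ gradedPart (initialIdeal ord J) (e + 1),
        ∃ b : Fin (n + 1) → MvPolynomial (Fin (n + 1)) k,
          (∀ i, b i ∈ gradedPart (initialIdeal ord J) e) ∧ f = ∑ i, X i * b i := by
  have hK := isGraded_initialIdeal ord J
  have hsat := hm₀ (sat (initialIdeal ord J)) hK.sat (isSat_sat _) (by
    filter_upwards [Filter.eventually_ge_atTop m₀, gradedPart_sat_eventually hK] with e h1 h2
    rw [h2, finrank_gradedPart_initialIdeal ord hJ, hQ e h1])
  -- Both spaces have dimension `Q e`: the saturation by the uniform bound, the initial ideal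
  -- because it has the dimensions of `J`.
  have heq : gradedPart (sat (initialIdeal ord J)) e = gradedPart (initialIdeal ord J) e := by
    refine (Submodule.eq_of_le_of_finrank_eq (gradedPart_mono (le_sat _) e) ?_).symm
    rw [finrank_gradedPart_initialIdeal ord hJ]
    have h1 := (hsat e he).1
    have h2 := hQ e he
    omega
  refine ⟨heq, fun f hf => ?_⟩
  rw [← heq]
  exact (hsat e he).2 f (gradedPart_mono (le_sat _) _ hf)

/-- The saturated graded ideals with given eventual Hilbert function are uniformly regular. -/
theorem exists_uniform_isRegularIdeal [Infinite k] (n : ℕ) (Q : ℕ → ℤ) :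
    ∃ M : ℕ, ∀ J : Ideal (MvPolynomial (Fin (n + 1)) k), IsGraded J → IsSat J →
      (∀ᶠ e in Filter.atTop, (Module.finrank k (gradedPart J e) : ℤ) = Q e) →
      IsRegularIdeal J M := by
  classical
  obtain ⟨m₀, hm₀⟩ := exists_uniform_bound (k := k) (n + 1) Q
  -- Beyond `m₀`, an initial ideal agrees with the ideal `N A` generated by its monomials of degree
  -- `m₀`. There are finitely many sets `A`, so a common regularity bound exists.
  let N : Finset (Fin (n + 1) →₀ ℕ) → Ideal (MvPolynomial (Fin (n + 1)) k) :=
    fun A => Ideal.span ((fun a => monomial a (1 : k)) '' (A : Set (Fin (n + 1) →₀ ℕ)))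
  choose mA hmA using fun A : Finset (Fin (n + 1) →₀ ℕ) =>
    exists_isRegularIdeal (isGraded_span_monomial (k := k)
    (A : Set (Fin (n + 1) →₀ ℕ)))
  let ord : MonomialOrder (Fin (n + 1)) := MonomialOrder.lex
  refine ⟨m₀ + (exponents (Fin (n + 1)) m₀).powerset.sup mA, fun J hJ hJs hQ => ?_⟩
  rw [isRegularIdeal_iff]
  intro e he
  set K := initialIdeal ord J with hK
  have hfin : (leadingExponents ord (gradedPart J m₀)).Finite :=
    (Finset.finite_toSet _).subset (leadingExponents_subset_exponents ord (gradedPart_le J m₀))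
  set A := hfin.toFinset with hA
  have hAm : A ∈ (exponents (Fin (n + 1)) m₀).powerset := by
    rw [Finset.mem_powerset]
    intro a ha
    exact leadingExponents_subset_exponents ord (gradedPart_le J m₀) (hfin.mem_toFinset.1 ha)
  have hK0 : gradedPart K m₀ = restrictSupport k (A : Set (Fin (n + 1) →₀ ℕ)) := by
    rw [hK, gradedPart_initialIdeal ord hJ, hA, hfin.coe_toFinset]
  have hNK : N A ≤ K := by
    refine Ideal.span_le.2 ?_
    rintro _ ⟨a, ha, rfl⟩
    have : monomial a (1 : k) ∈ gradedPart K m₀ := by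
      rw [hK0, monomial_mem_restrictSupport]; exact Or.inl ha
    exact this.1
  have hKN : ∀ i, gradedPart K (m₀ + i) = gradedPart (N A) (m₀ + i) := by
    intro i
    refine le_antisymm ?_ (gradedPart_mono hNK _)
    induction i with
    | zero =>
      intro f hf
      refine ⟨?_, hf.2⟩
      rw [add_zero, hK0] at hf
      change f ∈ N A
      rw [mem_ideal_span_monomial_image]
      exact fun a ha => ⟨a, hf ha, le_rfl⟩
    | succ i ih =>
      intro f hf
      obtain ⟨b, hb, hfb⟩ := (gradedPart_sat_initialIdeal ord hm₀ hJ
        (fun e he => (hm₀ J hJ hJs hQ e he).1) (e := m₀ + i) (by omega)).2 f hf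
      refine ⟨?_, hf.2⟩
      change f ∈ N A
      rw [hfb]
      exact Ideal.sum_mem _ fun j _ => Ideal.mul_mem_left _ _ (ih (hb j)).1
  obtain ⟨i, rfl⟩ : ∃ i, e = m₀ + i + 1 := ⟨e - m₀ - 1, by omega⟩
  apply KoszulExactAt.of_initialIdeal ord hJ
  have hreg := hmA A (m₀ + i + 1) (by
    have := Finset.le_sup (f := mA) hAm
    omega)
  intro c hc hc0
  obtain ⟨b, hb, hbc⟩ := hreg c (fun s => by
    have := hc s
    rw [← hK, add_assoc, hKN] at this
    exact this) hc0
  refine ⟨b, fun s => ?_, hbc⟩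
  rw [Nat.add_sub_cancel, ← hK, hKN]
  exact hb s

end UniformRegularity

/-! ### Hilbert functions of regular ideals -/

section HilbertPolynomial

variable {k : Type*} [Field k] {n : ℕ}

/-- The strand of the Koszul complex of `J` with exterior degree `i` and coefficients of
degree `e`. -/
noncomputable def koszulChains (J : Ideal (MvPolynomial (Fin (n + 1)) k)) (i e : ℕ) :
    Submodule k (Finset (Fin (n + 1)) → MvPolynomial (Fin (n + 1)) k) where
  carrier := {c | ∀ s, c s ∈ gradedPart J e ∧ (s.card ≠ i → c s = 0)}
  add_mem' := fun hb hc s => ⟨Submodule.add_mem _ (hb s).1 (hc s).1, fun h => by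
    rw [Pi.add_apply, (hb s).2 h, (hc s).2 h, add_zero]⟩
  zero_mem' := fun _ => ⟨Submodule.zero_mem _, fun _ => rfl⟩
  smul_mem' := fun a c hc s => ⟨Submodule.smul_mem _ a (hc s).1, fun h => by
    rw [Pi.smul_apply, (hc s).2 h, smul_zero]⟩

/-- Chains of exterior degree `i` are families indexed by the sets of size `i`. -/
noncomputable def koszulChainsEquiv (J : Ideal (MvPolynomial (Fin (n + 1)) k)) (i e : ℕ) :
    koszulChains J i e ≃ₗ[k] ({s : Finset (Fin (n + 1)) // s.card = i} → gradedPart J e) where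
  toFun c s := ⟨c.1 s.1, (c.2 s.1).1⟩
  map_add' _ _ := rfl
  map_smul' _ _ := rfl
  invFun c := ⟨fun s => if h : s.card = i then (c ⟨s, h⟩ : MvPolynomial (Fin (n + 1)) k) else 0, by
    intro s
    by_cases h : s.card = i
    · simp [h]
    · simp [h]⟩
  left_inv c := by
    ext1; ext1 s
    by_cases h : s.card = i
    · simp [h]
    · simp [h, (c.2 s).2 h]
  right_inv c := by
    ext1 s; ext1
    simp [s.2]

instance finite_koszulChains (J : Ideal (MvPolynomial (Fin (n + 1)) k)) (i e : ℕ) :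
    Module.Finite k (koszulChains J i e) :=
  Module.Finite.equiv (koszulChainsEquiv J i e).symm

theorem finrank_koszulChains (J : Ideal (MvPolynomial (Fin (n + 1)) k)) (i e : ℕ) :
    Module.finrank k (koszulChains J i e) =
      (n + 1).choose i * Module.finrank k (gradedPart J e) := by
  rw [(koszulChainsEquiv J i e).finrank_eq, Module.finrank_pi_fintype]
  simp [Fintype.card_finset_len]

/-- The Koszul differential over the base field. -/
noncomputable def koszulScalarMap (k : Type*) [Field k] (n : ℕ) :
    (Finset (Fin (n + 1)) → MvPolynomial (Fin (n + 1)) k) →ₗ[k]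
      (Finset (Fin (n + 1)) → MvPolynomial (Fin (n + 1)) k) :=
  (koszulMap k n).restrictScalars k

theorem koszulScalarMap_apply (c : Finset (Fin (n + 1)) → MvPolynomial (Fin (n + 1)) k) :
    koszulScalarMap k n c = koszulDiff c := rfl

theorem koszulDiff_restrict (i : ℕ)
    (b : Finset (Fin (n + 1)) → MvPolynomial (Fin (n + 1)) k) (t : Finset (Fin (n + 1))) :
    koszulDiff (fun s => if s.card = i + 1 then b s else 0) t =
      if t.card = i then koszulDiff b t else 0 := by
  rw [koszulDiff_apply, koszulDiff_apply]
  split_ifs with h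
  · refine Finset.sum_congr rfl fun a ha => ?_
    rw [if_pos]
    rw [Finset.card_insert_of_notMem (Finset.mem_compl.1 ha), h]
  · refine Finset.sum_eq_zero fun a ha => ?_
    rw [if_neg, mul_zero]
    rw [Finset.card_insert_of_notMem (Finset.mem_compl.1 ha)]
    omega

theorem KoszulExactAt.map_koszulChains {J : Ideal (MvPolynomial (Fin (n + 1)) k)} {e : ℕ}
    (h : KoszulExactAt J (e + 1)) (i : ℕ) :
    koszulChains J i (e + 1) ⊓ LinearMap.ker (koszulScalarMap k n) =
      (koszulChains J (i + 1) e).map (koszulScalarMap k n) := by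
  apply le_antisymm
  · rintro c ⟨hc, hc0⟩
    obtain ⟨b, hb, hbc⟩ := h c (fun s => (hc s).1) hc0
    refine ⟨fun s => if s.card = i + 1 then b s else 0, fun s => ⟨?_, fun hs => if_neg hs⟩, ?_⟩
    · dsimp only
      split_ifs
      · exact hb s
      · exact Submodule.zero_mem _
    · ext1 t
      rw [koszulScalarMap_apply, koszulDiff_restrict, hbc]
      split_ifs with ht
      · rfl
      · exact ((hc t).2 ht).symm
  · rintro _ ⟨b, hb, rfl⟩
    refine ⟨fun t => ⟨koszulDiff_mem_gradedPart (fun s => (hb s).1) t, fun ht => ?_⟩,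
      koszulDiff_koszulDiff b⟩
    have hbr : b = fun s => if s.card = i + 1 then b s else 0 := by
      ext1 s
      split_ifs with hs
      · rfl
      · exact (hb s).2 hs
    rw [koszulScalarMap_apply, hbr, koszulDiff_restrict, if_neg ht]

theorem finrank_map_add_finrank_inf_ker {V W : Type*} [AddCommGroup V] [Module k V]
    [AddCommGroup W] [Module k W] (f : V →ₗ[k] W) (p : Submodule k V) [Module.Finite k p] :
    Module.finrank k (p.map f) + Module.finrank k (p ⊓ LinearMap.ker f : Submodule k V) =
      Module.finrank k p := by
  have h := LinearMap.finrank_range_add_finrank_ker (f.domRestrict p)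
  rw [LinearMap.range_domRestrict] at h
  rw [← h, ← Submodule.finrank_map_subtype_eq p (LinearMap.ker (f.domRestrict p)),
    LinearMap.ker_domRestrict, Submodule.map_comap_subtype]

/-- The Euler characteristic of the Koszul strands of a regular ideal vanishes. -/
theorem IsRegularIdeal.sum_choose_mul_finrank_eq_zero {J : Ideal (MvPolynomial (Fin (n + 1)) k)}
    {m : ℕ} (h : IsRegularIdeal J m) {E : ℕ} (hE : m ≤ E) :
    ∑ i ∈ Finset.range (n + 2), (-1 : ℤ) ^ i * ((n + 1).choose i *
      Module.finrank k (gradedPart J (E + (n + 1 - i)))) = 0 := by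
  -- `ρ i` is the rank of the differential leaving exterior degree `i`. By exactness each dimension
  -- is a sum of two consecutive ranks, so the alternating sum telescopes.
  let ρ : ℕ → ℕ := fun i =>
    Module.finrank k ((koszulChains J i (E + (n + 1 - i))).map (koszulScalarMap k n))
  have h1 : ∀ i, i < n + 1 → ((n + 1).choose i *
      Module.finrank k (gradedPart J (E + (n + 1 - i))) : ℤ) = ρ i + ρ (i + 1) := by
    intro i hi
    obtain ⟨j, hj⟩ : ∃ j, n + 1 - i = j + 1 := ⟨n - i, by omega⟩
    have hj' : n + 1 - (i + 1) = j := by omega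
    have h2 := (isRegularIdeal_iff.1 h (E + j + 1) (by omega)).map_koszulChains i
    have h3 := finrank_map_add_finrank_inf_ker (koszulScalarMap k n)
      (koszulChains J i (E + (n + 1 - i)))
    rw [finrank_koszulChains] at h3
    rw [hj, ← add_assoc, h2, ← hj'] at h3
    simp only [ρ]
    rw [hj, ← add_assoc]
    rw [hj'] at h3 ⊢
    exact_mod_cast h3.symm
  have h2 : (((n + 1).choose (n + 1) *
      Module.finrank k (gradedPart J (E + (n + 1 - (n + 1))))) : ℤ) = ρ (n + 1) := by
    have h3 := finrank_map_add_finrank_inf_ker (koszulScalarMap k n)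
      (koszulChains J (n + 1) (E + (n + 1 - (n + 1))))
    rw [finrank_koszulChains] at h3
    -- The differential out of top exterior degree is always injective. No regularity is used in
    -- this spot, so its coefficient degree `E` may be `m` itself.
    have h4 : koszulChains J (n + 1) (E + (n + 1 - (n + 1))) ⊓
        LinearMap.ker (koszulScalarMap k n) = ⊥ := by
      rw [eq_bot_iff]
      rintro c ⟨hc, hc0⟩
      have hcard : ∀ s : Finset (Fin (n + 1)), s.card = n + 1 → s = Finset.univ := fun s hs =>
        (Finset.card_eq_iff_eq_univ s).1 (by simpa using hs)
      have hcu : c Finset.univ = 0 := by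
        have h5 : koszulDiff c (Finset.univ.erase 0) = 0 := congrFun (show koszulDiff c = 0 from hc0) _
        rw [koszulDiff_apply] at h5
        have h6 : (Finset.univ.erase (0 : Fin (n + 1)))ᶜ = {0} := by ext a; simp
        rw [h6, Finset.sum_singleton, Finset.insert_erase (Finset.mem_univ _)] at h5
        rcases mul_eq_zero.1 h5 with h7 | h7
        · rcases mul_eq_zero.1 h7 with h8 | h8
          · have := koszulSign_mul_self (k := k) 0 (Finset.univ.erase (0 : Fin (n + 1)))
            rw [h8] at this; simp at this
          · exact absurd h8 (X_ne_zero _)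
        · exact h7
      rw [Submodule.mem_bot]
      ext1 s
      by_cases hs : s.card = n + 1
      · rw [hcard s hs, hcu]; rfl
      · exact (hc s).2 hs
    rw [h4, finrank_bot, add_zero] at h3
    exact_mod_cast h3.symm
  have h3 : ρ 0 = 0 := by
    have : (koszulChains J 0 (E + (n + 1 - 0))).map (koszulScalarMap k n) = ⊥ := by
      rw [eq_bot_iff]
      rintro _ ⟨c, hc, rfl⟩
      rw [Submodule.mem_bot]
      ext1 t
      rw [koszulScalarMap_apply, koszulDiff_apply]
      refine Finset.sum_eq_zero fun a _ => ?_
      rw [(hc _).2 (by simp), mul_zero]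
    simp only [ρ]
    rw [this, finrank_bot]
  have h4 : ∀ j, j ≤ n + 1 → ∑ i ∈ Finset.range j, (-1 : ℤ) ^ i * ((n + 1).choose i *
      Module.finrank k (gradedPart J (E + (n + 1 - i)))) = -(-1) ^ j * ρ j := by
    intro j hj
    induction j with
    | zero => simp [h3]
    | succ j ih =>
      rw [Finset.sum_range_succ, ih (by omega), h1 j (by omega)]
      ring
  rw [Finset.sum_range_succ, h4 (n + 1) le_rfl, h2]
  ring

theorem finrank_homogeneousSubmodule (e : ℕ) :
    Module.finrank k (homogeneousSubmodule (Fin (n + 1)) k e) = (n + e).choose e := by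
  classical
  have h : homogeneousSubmodule (Fin (n + 1)) k e =
      restrictSupport k (exponents (Fin (n + 1)) e : Set (Fin (n + 1) →₀ ℕ)) := by
    rw [homogeneousSubmodule_eq_finsupp_supported]
    congr 1
    ext a
    simp [mem_exponents]
  have h2 := Finset.card_finsuppAntidiag_nat_eq_choose (s := (Finset.univ : Finset (Fin (n + 1)))) e
  rw [Finset.card_univ, Fintype.card_fin, Nat.add_right_comm, Nat.add_sub_cancel] at h2
  rw [h, finrank_restrictSupport, Set.ncard_coe_finset, ← h2, exponents]
  convert rfl

theorem hilbertFunction_add_finrank_gradedPart (J : Ideal (MvPolynomial (Fin (n + 1)) k)) (e : ℕ) :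
    hilbertFunction J e + Module.finrank k (gradedPart J e) = (n + e).choose e := by
  have h : gradedPart J e = homogeneousSubmodule (Fin (n + 1)) k e ⊓
      LinearMap.ker (Ideal.Quotient.mkₐ k J).toLinearMap := by
    ext f
    rw [mem_gradedPart, Submodule.mem_inf, LinearMap.mem_ker, and_comm]
    exact and_congr Iff.rfl Ideal.Quotient.eq_zero_iff_mem.symm
  rw [← finrank_homogeneousSubmodule (k := k), hilbertFunction,
    ← finrank_map_add_finrank_inf_ker (Ideal.Quotient.mkₐ k J).toLinearMap
      (homogeneousSubmodule (Fin (n + 1)) k e), h]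

/-- As the last coefficient is nonzero, each value is determined by the following ones, so eventual
vanishing propagates down to `m`. -/
theorem eq_zero_of_backward_recursion {N m : ℕ} {c : ℕ → ℚ} (hc : c (N + 1) ≠ 0) {δ : ℕ → ℚ}
    (h : ∀ E, m ≤ E → ∑ i ∈ Finset.range (N + 2), c i * δ (E + (N + 1 - i)) = 0)
    (hev : ∀ᶠ e in Filter.atTop, δ e = 0) : ∀ e, m ≤ e → δ e = 0 := by
  obtain ⟨B, hB⟩ := Filter.eventually_atTop.1 hev
  have key : ∀ j e, m ≤ e → B ≤ e + j → δ e = 0 := by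
    intro j
    induction j using Nat.strong_induction_on with
    | _ j ih =>
      intro e he hj
      rcases Nat.eq_zero_or_pos j with rfl | hj0
      · exact hB e hj
      · have h1 := h e he
        rw [Finset.sum_range_succ, Finset.sum_eq_zero, zero_add] at h1
        · simpa [hc] using h1
        · intro i hi
          rw [Finset.mem_range] at hi
          rw [ih (j - 1) (by omega) _ (by omega) (by omega), mul_zero]
  exact fun e he => key B e he (by omega)

/-- The Hilbert function of an `m`-regular ideal is polynomial from `m` on. -/
theorem IsRegularIdeal.hilbertFunction_eq {J : Ideal (MvPolynomial (Fin (n + 1)) k)} {m : ℕ}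
    (h : IsRegularIdeal J m) {P : Polynomial ℚ} (hP : HasHilbertPolynomial J P) :
    (hilbertFunction J m : ℚ) = P.eval (m : ℚ) := by
  -- `q` is the polynomial expected for dim J_e, and `δ` below is the deviation from it. The
  -- dimensions satisfy the Koszul recursion; `q` satisfies it for large arguments, hence
  -- identically.
  let q : Polynomial ℚ := Polynomial.preHilbertPoly ℚ n 0 - P
  have hdim : ∀ e : ℕ, (Module.finrank k (gradedPart J e) : ℚ) - q.eval (e : ℚ) =
      P.eval (e : ℚ) - hilbertFunction J e := by
    intro e
    have h1 := hilbertFunction_add_finrank_gradedPart J e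
    have h2 : (Polynomial.preHilbertPoly ℚ n 0).eval (e : ℚ) = ((n + e).choose e : ℕ) := by
      rw [Polynomial.preHilbertPoly_eq_choose_sub_add ℚ n (Nat.zero_le e), Nat.sub_zero,
        add_comm e, ← Nat.choose_symm_add]
    rw [Polynomial.eval_sub, h2, ← h1]
    push_cast; ring
  let δ : ℕ → ℚ := fun e => Module.finrank k (gradedPart J e) - q.eval (e : ℚ)
  have hδ : ∀ᶠ e in Filter.atTop, δ e = 0 := by
    filter_upwards [hP] with e he
    simp only [δ]
    rw [hdim, he, sub_self]
  let c : ℕ → ℚ := fun i => (-1) ^ i * (n + 1).choose i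
  have hrec : ∀ E, m ≤ E → ∑ i ∈ Finset.range (n + 2),
      c i * (Module.finrank k (gradedPart J (E + (n + 1 - i))) : ℚ) = 0 := by
    intro E hE
    have := h.sum_choose_mul_finrank_eq_zero hE
    have h2 := congrArg (Int.cast : ℤ → ℚ) this
    push_cast at h2
    rw [← h2]
    exact Finset.sum_congr rfl fun i _ => by simp only [c]; ring
  let w : Polynomial ℚ := ∑ i ∈ Finset.range (n + 2),
    Polynomial.C (c i) * q.comp (Polynomial.X + Polynomial.C ((n + 1 - i : ℕ) : ℚ))
  have hw : ∀ E : ℕ, w.eval (E : ℚ) =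
      ∑ i ∈ Finset.range (n + 2), c i * q.eval ((E + (n + 1 - i) : ℕ) : ℚ) := by
    intro E
    simp only [w, Polynomial.eval_finsetSum, Polynomial.eval_mul, Polynomial.eval_C,
      Polynomial.eval_comp, Polynomial.eval_add, Polynomial.eval_X]
    exact Finset.sum_congr rfl fun i _ => by push_cast; rfl
  have hw0 : w = 0 := by
    apply Polynomial.eq_zero_of_infinite_isRoot
    obtain ⟨B, hB⟩ := Filter.eventually_atTop.1 hδ
    have hinf : (Set.Ici (B + m)).Infinite := Set.Ici_infinite _
    refine (hinf.image (Nat.cast_injective (R := ℚ)).injOn).mono ?_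
    rintro _ ⟨E, hE, rfl⟩
    rw [Set.mem_Ici] at hE
    change w.eval (E : ℚ) = 0
    rw [hw, ← hrec E (by omega)]
    refine Finset.sum_congr rfl fun i _ => ?_
    rw [sub_eq_zero.1 (hB (E + (n + 1 - i)) (by omega))]
  have := eq_zero_of_backward_recursion (N := n) (m := m) (c := c) (δ := δ) (by simp [c]) (by
    intro E hE
    have h1 := hw E
    rw [hw0, Polynomial.eval_zero] at h1
    simp only [δ, mul_sub, Finset.sum_sub_distrib]
    rw [hrec E hE, ← h1, sub_zero]) hδ m le_rfl
  simp only [δ] at this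
  rw [hdim] at this
  linarith

end HilbertPolynomial

/-! ### The Gotzmann number -/

section Gotzmann

variable {k : Type*} [Field k] {n : ℕ}

section
attribute [local instance] MvPolynomial.gradedAlgebra

theorem isHomogeneousIdeal_iff {J : Ideal (MvPolynomial (Fin (n + 1)) k)} :
    IsHomogeneousIdeal J ↔ IsGraded J := by
  constructor
  · exact fun h f hf e => homogeneousComponent_mem_of_mem h hf e
  · intro h e f hf
    have := h f hf e
    rwa [← decomposition.decompose'_apply] at this

end

theorem isSaturatedHomogeneous_iff {J : Ideal (MvPolynomial (Fin (n + 1)) k)} :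
    IsSaturatedHomogeneous J ↔ IsGraded J ∧ IsSat J :=
  and_congr isHomogeneousIdeal_iff sat_eq_iff

theorem HasHilbertPolynomial.eventually_finrank {J : Ideal (MvPolynomial (Fin (n + 1)) k)}
    {P : Polynomial ℚ} (hP : HasHilbertPolynomial J P) :
    ∀ᶠ e : ℕ in Filter.atTop, (Module.finrank k (gradedPart J e) : ℤ) =
      (n + e).choose e - ⌊P.eval (e : ℚ)⌋ := by
  filter_upwards [hP] with e he
  rw [← he, Int.floor_natCast, ← hilbertFunction_add_finrank_gradedPart J e]
  push_cast; ring

theorem HasHilbertPolynomial.of_eventually_finrank {J K : Ideal (MvPolynomial (Fin (n + 1)) k)}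
    {P : Polynomial ℚ} (hP : HasHilbertPolynomial J P)
    (h : ∀ᶠ e : ℕ in Filter.atTop,
      Module.finrank k (gradedPart K e) = Module.finrank k (gradedPart J e)) :
    HasHilbertPolynomial K P := by
  refine (Filter.Eventually.and hP h).mono ?_
  rintro e ⟨he, he'⟩
  rw [← he]
  have h1 := hilbertFunction_add_finrank_gradedPart J e
  have h2 := hilbertFunction_add_finrank_gradedPart K e
  have h3 : hilbertFunction K e = hilbertFunction J e := by omega
  rw [h3]

theorem IsRegularIdeal.mono {J : Ideal (MvPolynomial (Fin (n + 1)) k)} {m m' : ℕ}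
    (h : IsRegularIdeal J m) (hm : m ≤ m') : IsRegularIdeal J m' :=
  fun e he => h e (hm.trans_lt he)

/-- The Gotzmann number bounds the regularity of the saturated homogeneous ideals with the given
Hilbert polynomial. -/
theorem isRegularIdeal_of_gotzmannNumber_le [Infinite k] {P : Polynomial ℚ} {m : ℕ}
    (hm : gotzmannNumber k n P ≤ m) {J : Ideal (MvPolynomial (Fin (n + 1)) k)}
    (hJ : IsSaturatedHomogeneous J) (hP : HasHilbertPolynomial J P) : IsRegularIdeal J m := by
  obtain ⟨M, hM⟩ := exists_uniform_isRegularIdeal (k := k) n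
    fun e => (n + e).choose e - ⌊P.eval (e : ℚ)⌋
  -- Without nonemptiness the infimum would be the default value 0 and would bound nothing.
  have hne : {m₀ : ℕ | ∀ m : ℕ, m₀ ≤ m → ∀ J : Ideal (MvPolynomial (Fin (n + 1)) k),
      IsSaturatedHomogeneous J → HasHilbertPolynomial J P → IsRegularIdeal J m}.Nonempty :=
    ⟨M, fun m hm J hJ hP => by
      rw [isSaturatedHomogeneous_iff] at hJ
      exact (hM J hJ.1 hJ.2 hP.eventually_finrank).mono hm⟩
  exact Nat.sInf_mem hne m hm J hJ hP

/-- An `m`-regular ideal is generated in degrees at most `m`. -/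
theorem IsRegularIdeal.exists_eq_sum {J : Ideal (MvPolynomial (Fin (n + 1)) k)} {m : ℕ}
    (h : IsRegularIdeal J m) {e : ℕ} (he : m ≤ e) {f : MvPolynomial (Fin (n + 1)) k}
    (hf : f ∈ gradedPart J (e + 1)) : ∃ b : Fin (n + 1) → MvPolynomial (Fin (n + 1)) k,
      (∀ i, b i ∈ gradedPart J e) ∧ f = ∑ i, X i * b i := by
  classical
  -- An element of `J` is a cycle in exterior degree 0; a chain bounding it supplies the
  -- coefficients of the variables.
  obtain ⟨b, hb, hbf⟩ := h (e + 1) (by omega) (fun s => if s = ∅ then f else 0) (by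
    intro s
    split_ifs
    · exact hf
    · exact Submodule.zero_mem _) (by
    ext1 t
    rw [koszulDiff_apply]
    exact Finset.sum_eq_zero fun a _ => by simp)
  refine ⟨fun i => b {i}, fun i => hb {i}, ?_⟩
  have := congrFun hbf ∅
  rw [koszulDiff_apply] at this
  simpa [koszulSign] using this.symm

end Gotzmann

/-! ### The action of GL and the Borel subgroup -/

section LinearGroupAction

variable {k : Type*} [Field k] {n : ℕ}

theorem glAct_X (g : GL (Fin (n + 1)) k) (i : Fin (n + 1)) :
    glAct g (X i) = ∑ j, C ((g : Matrix (Fin (n + 1)) (Fin (n + 1)) k) j i) * X j := by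
  rw [glAct, aeval_X]

theorem glAct_mul (b g : GL (Fin (n + 1)) k) : glAct (b * g) = (glAct b).comp (glAct g) := by
  ext1 i
  simp only [AlgHom.comp_apply, glAct_X, map_sum, map_mul, Units.val_mul, Matrix.mul_apply,
    Finset.sum_mul, Finset.mul_sum]
  rw [Finset.sum_comm]
  refine Finset.sum_congr rfl fun j _ => Finset.sum_congr rfl fun l _ => ?_
  rw [← algebraMap_eq, AlgHom.commutes]
  ring

theorem glAct_one : glAct (1 : GL (Fin (n + 1)) k) = AlgHom.id k _ := by
  ext1 i
  rw [glAct_X, Finset.sum_eq_single i]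
  · simp
  · intro j _ h; simp [Matrix.one_apply_ne h]
  · simp

theorem glAct_bijective (g : GL (Fin (n + 1)) k) : Function.Bijective (glAct g) := by
  have h : ∀ g : GL (Fin (n + 1)) k, Function.LeftInverse (glAct g⁻¹) (glAct g) := by
    intro g f
    rw [← AlgHom.comp_apply, ← glAct_mul, inv_mul_cancel, glAct_one, AlgHom.id_apply]
  refine ⟨(h g).injective, ?_⟩
  have := (h g⁻¹).surjective
  rwa [inv_inv] at this

theorem glAct_isHomogeneous (g : GL (Fin (n + 1)) k) (f : MvPolynomial (Fin (n + 1)) k) (e : ℕ)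
    (hf : f.IsHomogeneous e) : (glAct g f).IsHomogeneous e := by
  have := hf.aeval (fun i => ∑ j, C ((g : Matrix (Fin (n + 1)) (Fin (n + 1)) k) j i) * X j)
    fun i => isHomogeneous_linear _
  rwa [one_mul] at this

theorem mem_glIdeal {g : GL (Fin (n + 1)) k} {J : Ideal (MvPolynomial (Fin (n + 1)) k)}
    {f : MvPolynomial (Fin (n + 1)) k} : f ∈ glIdeal g J ↔ ∃ h ∈ J, glAct g h = f :=
  Ideal.mem_map_iff_of_surjective (glAct g) (glAct_bijective g).2

theorem glIdeal_mul (b g : GL (Fin (n + 1)) k) (J : Ideal (MvPolynomial (Fin (n + 1)) k)) :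
    glIdeal (b * g) J = glIdeal b (glIdeal g J) := by
  ext f
  simp only [mem_glIdeal, glAct_mul, AlgHom.comp_apply]
  constructor
  · rintro ⟨h, hh, rfl⟩; exact ⟨_, ⟨h, hh, rfl⟩, rfl⟩
  · rintro ⟨_, ⟨h, hh, rfl⟩, rfl⟩; exact ⟨h, hh, rfl⟩

theorem IsGraded.glIdeal {J : Ideal (MvPolynomial (Fin (n + 1)) k)} (hJ : IsGraded J)
    (g : GL (Fin (n + 1)) k) : IsGraded (glIdeal g J) :=
  hJ.map_of_surjective (glAct_bijective g).2 (glAct_isHomogeneous g)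

theorem gradedPart_glIdeal {J : Ideal (MvPolynomial (Fin (n + 1)) k)} (hJ : IsGraded J)
    (g : GL (Fin (n + 1)) k) (e : ℕ) :
    gradedPart (glIdeal g J) e = (gradedPart J e).map (glAct g).toLinearMap :=
  gradedPart_map_of_surjective hJ (glAct_bijective g).2 (glAct_isHomogeneous g) e

theorem finrank_gradedPart_glIdeal {J : Ideal (MvPolynomial (Fin (n + 1)) k)} (hJ : IsGraded J)
    (g : GL (Fin (n + 1)) k) (e : ℕ) :
    Module.finrank k (gradedPart (glIdeal g J) e) = Module.finrank k (gradedPart J e) := by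
  rw [gradedPart_glIdeal hJ]
  exact (Submodule.equivMapOfInjective _ (glAct_bijective g).1 _).finrank_eq.symm

/-- A nonzero determinant has a nonzero term, given by a permutation `s`. The Borel condition yields
`x_{s i} ⪯ x_i` for all `i`; equal sums over all variables force equality throughout, so `s` is the
identity. -/
theorem diagonal_ne_zero_of_mem_standardBorel {ord : MonomialOrder (Fin (n + 1))}
    {b : GL (Fin (n + 1)) k} (hb : b ∈ standardBorel k ord) (i : Fin (n + 1)) :
    (b : Matrix (Fin (n + 1)) (Fin (n + 1)) k) i i ≠ 0 := by
  have hdet : (b : Matrix (Fin (n + 1)) (Fin (n + 1)) k).det ≠ 0 :=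
    ((Matrix.isUnit_iff_isUnit_det _).1 b.isUnit).ne_zero
  rw [Matrix.det_apply] at hdet
  obtain ⟨s, -, hs⟩ := Finset.exists_ne_zero_of_sum_ne_zero hdet
  have hprod : ∀ i, (b : Matrix (Fin (n + 1)) (Fin (n + 1)) k) (s i) i ≠ 0 := by
    intro i hi
    exact hs (by rw [Finset.prod_eq_zero (f := fun i =>
      (b : Matrix (Fin (n + 1)) (Fin (n + 1)) k) (s i) i) (Finset.mem_univ i) hi, smul_zero])
  let β : Fin (n + 1) → ord.syn := fun i => ord.toSyn (Finsupp.single i 1)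
  have hle : ∀ i ∈ Finset.univ, β (s i) ≤ β i := by
    intro i _
    by_contra h
    exact hprod i (hb i (s i) (not_le.1 h))
  have hsum : ∑ i, β (s i) = ∑ i, β i := Equiv.sum_comp s β
  have heq := (Finset.sum_eq_sum_iff_of_le hle).1 hsum i (Finset.mem_univ i)
  have : s i = i := Finsupp.single_left_injective one_ne_zero (ord.toSyn.injective heq)
  have h := hprod i
  rwa [this] at h

theorem degree_glAct_X {ord : MonomialOrder (Fin (n + 1))} {b : GL (Fin (n + 1)) k}
    (hb : b ∈ standardBorel k ord) (i : Fin (n + 1)) :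
    ord.degree (glAct b (X i)) = Finsupp.single i 1 := by
  have hcoeff : ∀ a, coeff a (glAct b (X i)) ≠ 0 →
      ∃ j, a = Finsupp.single j 1 ∧ (b : Matrix (Fin (n + 1)) (Fin (n + 1)) k) j i ≠ 0 := by
    classical
    intro a ha
    rw [glAct_X, coeff_sum] at ha
    obtain ⟨j, -, hj⟩ := Finset.exists_ne_zero_of_sum_ne_zero ha
    rw [coeff_C_mul, coeff_X] at hj
    refine ⟨j, ?_, left_ne_zero_of_mul hj⟩
    by_contra h
    rw [if_neg (fun h' => h h'.symm), mul_zero] at hj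
    exact hj rfl
  apply ord.toSyn.injective
  refine le_antisymm (ord.degree_le_iff.2 fun a ha => ?_) (ord.le_degree ?_)
  · obtain ⟨j, rfl, hj⟩ := hcoeff a (mem_support_iff.1 ha)
    by_contra h
    exact hj (hb i j (not_le.1 h))
  · classical
    rw [mem_support_iff, glAct_X, coeff_sum, Finset.sum_eq_single i]
    · rw [coeff_C_mul, coeff_X, if_pos rfl, mul_one]
      exact diagonal_ne_zero_of_mem_standardBorel hb i
    · intro j _ hj
      rw [coeff_C_mul, coeff_X, if_neg, mul_zero]
      exact fun h => hj (Finsupp.single_left_injective one_ne_zero h)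
    · simp

theorem degree_glAct_monomial {ord : MonomialOrder (Fin (n + 1))} {b : GL (Fin (n + 1)) k}
    (hb : b ∈ standardBorel k ord) (a : Fin (n + 1) →₀ ℕ) :
    ord.degree (glAct b (monomial a 1)) = a := by
  rw [monomial_eq, C_1, one_mul, Finsupp.prod_fintype _ _ (by simp), map_prod]
  rw [ord.degree_prod]
  · simp only [map_pow, ord.degree_pow, degree_glAct_X hb]
    ext i
    simp
  · intro i _
    rw [map_pow]
    refine pow_ne_zero _ fun h => ?_
    have := (glAct_bijective b).1 (h.trans (map_zero _).symm)
    exact X_ne_zero i this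

/-- The Borel subgroup preserves initial monomials. -/
theorem degree_glAct {ord : MonomialOrder (Fin (n + 1))} {b : GL (Fin (n + 1)) k}
    (hb : b ∈ standardBorel k ord) (f : MvPolynomial (Fin (n + 1)) k) :
    ord.degree (glAct b f) = ord.degree f := by
  by_cases hf : f = 0
  · simp [hf]
  have hsum : glAct b f = ∑ a ∈ f.support, coeff a f • glAct b (monomial a 1) := by
    conv_lhs => rw [f.as_sum, map_sum]
    refine Finset.sum_congr rfl fun a _ => ?_
    rw [← map_smul, smul_monomial, smul_eq_mul, mul_one]
  apply ord.toSyn.injective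
  refine le_antisymm (ord.degree_le_iff.2 fun d hd => ?_) (ord.le_degree ?_)
  · rw [mem_support_iff, hsum, coeff_sum] at hd
    obtain ⟨a, ha, had⟩ := Finset.exists_ne_zero_of_sum_ne_zero hd
    rw [coeff_smul] at had
    have h1 := ord.le_degree (mem_support_iff.2 (right_ne_zero_of_mul had))
    rw [degree_glAct_monomial hb] at h1
    exact h1.trans (ord.le_degree ha)
  · rw [mem_support_iff, hsum, coeff_sum, Finset.sum_eq_single (ord.degree f)]
    · rw [coeff_smul, smul_eq_mul]
      refine mul_ne_zero (ord.coeff_degree_ne_zero_iff.2 hf) ?_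
      have h1 : glAct b (monomial (ord.degree f) 1) ≠ 0 := by
        intro h
        have := (glAct_bijective b).1 (h.trans (map_zero _).symm)
        simp at this
      have h2 := ord.coeff_degree_ne_zero_iff.2 h1
      rwa [degree_glAct_monomial hb] at h2
    · intro a ha hne
      rw [coeff_smul, ord.coeff_eq_zero_of_lt (f := glAct b (monomial a 1)), smul_zero]
      rw [degree_glAct_monomial hb]
      exact lt_of_le_of_ne (ord.le_degree ha) fun h => hne (ord.toSyn.injective h)
    · exact fun h => absurd (ord.degree_mem_support hf) h

theorem leadingExponents_map_glAct {ord : MonomialOrder (Fin (n + 1))} {b : GL (Fin (n + 1)) k}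
    (hb : b ∈ standardBorel k ord) (F : Submodule k (MvPolynomial (Fin (n + 1)) k)) :
    leadingExponents ord (F.map (glAct b).toLinearMap) = leadingExponents ord F := by
  ext a
  constructor
  · rintro ⟨_, ⟨f, hf, rfl⟩, h0, rfl⟩
    exact ⟨f, hf, fun h => h0 (by simp [h]), (degree_glAct hb f).symm⟩
  · rintro ⟨f, hf, h0, rfl⟩
    refine ⟨_, ⟨f, hf, rfl⟩, fun h => h0 ?_, degree_glAct hb f⟩
    exact (glAct_bijective b).1 (h.trans (map_zero (glAct b)).symm)

theorem leadingExponents_gradedPart_glIdeal_mul {ord : MonomialOrder (Fin (n + 1))}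
    {b : GL (Fin (n + 1)) k} (hb : b ∈ standardBorel k ord) (g : GL (Fin (n + 1)) k)
    {J : Ideal (MvPolynomial (Fin (n + 1)) k)} (hJ : IsGraded J) (e : ℕ) :
    leadingExponents ord (gradedPart (glIdeal (b * g) J) e) =
      leadingExponents ord (gradedPart (glIdeal g J) e) := by
  rw [glIdeal_mul, gradedPart_glIdeal (hJ.glIdeal g), leadingExponents_map_glAct hb]

theorem initialIdeal_glIdeal_mul {ord : MonomialOrder (Fin (n + 1))}
    {b : GL (Fin (n + 1)) k} (hb : b ∈ standardBorel k ord) (g : GL (Fin (n + 1)) k)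
    {J : Ideal (MvPolynomial (Fin (n + 1)) k)} (hJ : IsGraded J) :
    initialIdeal ord (glIdeal (b * g) J) = initialIdeal ord (glIdeal g J) := by
  refine (isGraded_initialIdeal ord _).ext (isGraded_initialIdeal ord _) fun e => ?_
  rw [gradedPart_initialIdeal ord (hJ.glIdeal _), gradedPart_initialIdeal ord (hJ.glIdeal _),
    leadingExponents_gradedPart_glIdeal_mul hb g hJ]

end LinearGroupAction

/-! ### The Zariski topology and semicontinuity of ranks -/

section Zariski

variable {k : Type*} [Field k] {n : ℕ}

attribute [local instance] zariskiGL

/-- The value of a polynomial at the entries of a matrix. -/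
noncomputable def evalGL (g : GL (Fin (n + 1)) k) :
    MvPolynomial (Fin (n + 1) × Fin (n + 1)) k →+* k :=
  eval fun p => (g : Matrix (Fin (n + 1)) (Fin (n + 1)) k) p.1 p.2

theorem isOpen_evalGL_ne_zero (f : MvPolynomial (Fin (n + 1) × Fin (n + 1)) k) :
    IsOpen {g : GL (Fin (n + 1)) k | evalGL g f ≠ 0} :=
  TopologicalSpace.isOpen_generateFrom_of_mem ⟨f, rfl⟩

theorem exists_basic_open_subset {U : Set (GL (Fin (n + 1)) k)} (hU : IsOpen U)
    {g : GL (Fin (n + 1)) k} (hg : g ∈ U) :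
    ∃ f : MvPolynomial (Fin (n + 1) × Fin (n + 1)) k, evalGL g f ≠ 0 ∧
      ∀ g', evalGL g' f ≠ 0 → g' ∈ U := by
  induction hU with
  | basic s hs =>
    obtain ⟨f, rfl⟩ := hs
    exact ⟨f, hg, fun _ h => h⟩
  | univ => exact ⟨1, by simp, fun _ _ => trivial⟩
  | inter s t _ _ hs ht =>
    obtain ⟨f, hf, hf'⟩ := hs hg.1
    obtain ⟨f₂, hf₂, hf₂'⟩ := ht hg.2
    refine ⟨f * f₂, by rw [map_mul]; exact mul_ne_zero hf hf₂, fun g' h => ?_⟩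
    rw [map_mul] at h
    exact ⟨hf' _ (left_ne_zero_of_mul h), hf₂' _ (right_ne_zero_of_mul h)⟩
  | sUnion S _ ih =>
    obtain ⟨s, hs, hgs⟩ := hg
    obtain ⟨f, hf, hf'⟩ := ih s hs hgs
    exact ⟨f, hf, fun g' h => ⟨s, hs, hf' g' h⟩⟩

/-- The general linear group over an infinite field is irreducible. -/
theorem nonempty_inter_of_isOpen [Infinite k] {U V : Set (GL (Fin (n + 1)) k)} (hU : IsOpen U)
    (hV : IsOpen V) (hUn : U.Nonempty) (hVn : V.Nonempty) : (U ∩ V).Nonempty := by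
  obtain ⟨g, hg⟩ := hUn
  obtain ⟨g', hg'⟩ := hVn
  obtain ⟨f, hf, hfU⟩ := exists_basic_open_subset hU hg
  obtain ⟨f', hf', hfV⟩ := exists_basic_open_subset hV hg'
  -- The generic determinant is included in the product so that the nonvanishing point found below
  -- is an invertible matrix.
  let D : MvPolynomial (Fin (n + 1) × Fin (n + 1)) k :=
    (Matrix.of fun i j => (X (i, j) : MvPolynomial (Fin (n + 1) × Fin (n + 1)) k)).det
  have hD : ∀ x : Fin (n + 1) × Fin (n + 1) → k,
      eval x D = (Matrix.of fun i j => x (i, j)).det := by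
    intro x
    rw [RingHom.map_det]
    congr 1
    ext i j
    simp
  have h0 : ∀ f : MvPolynomial (Fin (n + 1) × Fin (n + 1)) k, ∀ x, eval x f ≠ 0 → f ≠ 0 := by
    rintro f x h rfl; simp at h
  have hne : f * f' * D ≠ 0 := by
    refine mul_ne_zero (mul_ne_zero (h0 _ _ hf) (h0 _ _ hf')) ?_
    refine h0 _ (fun p => (1 : Matrix (Fin (n + 1)) (Fin (n + 1)) k) p.1 p.2) ?_
    rw [hD]
    have : (Matrix.of fun i j => (1 : Matrix (Fin (n + 1)) (Fin (n + 1)) k) i j) = 1 := rfl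
    rw [this, Matrix.det_one]
    exact one_ne_zero
  obtain ⟨x, hx⟩ : ∃ x, eval x (f * f' * D) ≠ 0 := by
    by_contra! h
    exact hne (MvPolynomial.funext fun x => by rw [h x, map_zero])
  rw [map_mul, map_mul, hD] at hx
  let γ : GL (Fin (n + 1)) k :=
    Matrix.GeneralLinearGroup.mkOfDetNeZero _ (right_ne_zero_of_mul hx)
  have hγ : ∀ f, evalGL γ f = eval x f := fun f => rfl
  exact ⟨γ, hfU γ (by rw [hγ]; exact left_ne_zero_of_mul (left_ne_zero_of_mul hx)),
    hfV γ (by rw [hγ]; exact right_ne_zero_of_mul (left_ne_zero_of_mul hx))⟩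

theorem dense_of_isOpen [Infinite k] {U : Set (GL (Fin (n + 1)) k)} (hU : IsOpen U)
    (hUn : U.Nonempty) : Dense U :=
  dense_iff_inter_open.2 fun _ hV hVn => nonempty_inter_of_isOpen hV hU hVn hUn

theorem nonempty_biInter_of_isOpen [Infinite k] {ι : Type*} (s : Finset ι)
    {U : ι → Set (GL (Fin (n + 1)) k)} (hU : ∀ i ∈ s, IsOpen (U i))
    (hUn : ∀ i ∈ s, (U i).Nonempty) :
    IsOpen (⋂ i ∈ s, U i) ∧ (⋂ i ∈ s, U i).Nonempty := by
  classical
  induction s using Finset.induction_on with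
  | empty => simp
  | insert a s _ ih =>
    obtain ⟨h1, h2⟩ := ih (fun i hi => hU i (Finset.mem_insert_of_mem hi))
      fun i hi => hUn i (Finset.mem_insert_of_mem hi)
    have ha := hU a (Finset.mem_insert_self a s)
    rw [Finset.set_biInter_insert]
    exact ⟨ha.inter h1, nonempty_inter_of_isOpen ha h1 (hUn a (Finset.mem_insert_self a s)) h2⟩

/-- The action of the generic matrix. -/
noncomputable def genericAct (f : MvPolynomial (Fin (n + 1)) k) :
    MvPolynomial (Fin (n + 1)) (MvPolynomial (Fin (n + 1) × Fin (n + 1)) k) :=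
  eval₂Hom (C.comp C) (fun i => ∑ j, C (X (j, i)) * X j) f

theorem map_genericAct (g : GL (Fin (n + 1)) k) (f : MvPolynomial (Fin (n + 1)) k) :
    map (evalGL g) (genericAct f) = glAct g f := by
  have : (map (evalGL g)).comp (eval₂Hom (C.comp C)
      (fun i => ∑ j, C (X (j, i) : MvPolynomial (Fin (n + 1) × Fin (n + 1)) k) * X j)) =
      (glAct g : MvPolynomial (Fin (n + 1)) k →+* MvPolynomial (Fin (n + 1)) k) := by
    refine MvPolynomial.ringHom_ext (fun c => ?_) fun i => ?_
    · simp [evalGL, glAct]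
    · simp only [RingHom.comp_apply, coe_eval₂Hom, eval₂_X, map_sum, map_mul, map_C, map_X]
      rw [RingHom.coe_coe, glAct_X]
      simp [evalGL]
  exact RingHom.congr_fun this f

theorem evalGL_coeff_genericAct (g : GL (Fin (n + 1)) k) (f : MvPolynomial (Fin (n + 1)) k)
    (a : Fin (n + 1) →₀ ℕ) : evalGL g (coeff a (genericAct f)) = coeff a (glAct g f) := by
  rw [← map_genericAct, coeff_map]

/-- Semicontinuity of the rank of coefficients under the action of the general linear group. -/
theorem isOpen_le_finrank_map_coeffsAt (F : Submodule k (MvPolynomial (Fin (n + 1)) k))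
    (T : Finset (Fin (n + 1) →₀ ℕ)) (r : ℕ) :
    IsOpen {g : GL (Fin (n + 1)) k |
      r ≤ Module.finrank k ((F.map (glAct g).toLinearMap).map (coeffsAt k T))} := by
  rw [isOpen_iff_forall_mem_open]
  intro g₀ hg₀
  set V := (F.map (glAct g₀).toLinearMap).map (coeffsAt k T) with hV
  let B := Module.finBasis k V
  have hv : ∀ i : Fin r, ∃ f ∈ F, coeffsAt k T (glAct g₀ f) = B (Fin.castLE hg₀ i) := by
    intro i
    obtain ⟨_, ⟨f, hf, rfl⟩, hfi⟩ := (B (Fin.castLE hg₀ i)).2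
    exact ⟨f, hf, hfi⟩
  choose v hvF hvB using hv
  have hli : LinearIndependent k fun i : Fin r => coeffsAt k T (glAct g₀ (v i)) := by
    have h1 : LinearIndependent k fun i : Fin r => B (Fin.castLE hg₀ i) :=
      B.linearIndependent.comp _ (Fin.castLE_injective hg₀)
    have h2 := h1.map' V.subtype V.ker_subtype
    have h3 : (fun i : Fin r => coeffsAt k T (glAct g₀ (v i))) =
        V.subtype ∘ fun i => B (Fin.castLE hg₀ i) := funext hvB
    rw [h3]
    exact h2
  -- A left inverse `p` turns independence of `r` vectors at `g₀` into an `r × r` determinant that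
  -- is polynomial in the entries of `g` and equals 1 at `g₀`.
  obtain ⟨p, hp⟩ := LinearMap.exists_leftInverse_of_injective
    (Fintype.linearCombination k fun i : Fin r => coeffsAt k T (glAct g₀ (v i)))
    (LinearMap.ker_eq_bot.2 (LinearIndependent.fintypeLinearCombination_injective hli))
  let N : Matrix (Fin r) (Fin r) (MvPolynomial (Fin (n + 1) × Fin (n + 1)) k) :=
    Matrix.of fun i j => ∑ a : T, C (p (Pi.single a 1) i) * coeff a.1 (genericAct (v j))
  have hN : ∀ g, evalGL g N.det =
      (Matrix.of fun i j => p (coeffsAt k T (glAct g (v j))) i).det := by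
    intro g
    rw [RingHom.map_det]
    congr 1
    ext i j
    have h1 : coeffsAt k T (glAct g (v j)) =
        ∑ a : T, coeff a.1 (glAct g (v j)) • (Pi.single a 1 : T → k) :=
      pi_eq_sum_univ' _
    rw [Matrix.of_apply, h1, map_sum, Finset.sum_apply]
    simp only [N, RingHom.mapMatrix_apply, Matrix.map_apply, Matrix.of_apply, map_sum, map_mul,
      evalGL_coeff_genericAct, map_smul, Pi.smul_apply, smul_eq_mul]
    refine Finset.sum_congr rfl fun a _ => ?_
    rw [mul_comm]
    congr 1
    simp [evalGL]
  refine ⟨{g | evalGL g N.det ≠ 0}, fun g hg => ?_, isOpen_evalGL_ne_zero _, ?_⟩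
  · rw [Set.mem_ofPred_eq, hN] at hg
    have h1 := Matrix.linearIndependent_cols_of_det_ne_zero hg
    have h2 : LinearIndependent k fun j : Fin r => p (coeffsAt k T (glAct g (v j))) := h1
    have h3 : LinearIndependent k fun j : Fin r => coeffsAt k T (glAct g (v j)) :=
      LinearIndependent.of_comp p h2
    have h4 : LinearIndependent k (fun j : Fin r =>
        (⟨_, _, ⟨v j, hvF j, rfl⟩, rfl⟩ : (F.map (glAct g).toLinearMap).map (coeffsAt k T))) :=
      LinearIndependent.of_comp (Submodule.subtype _) h3
    have : Module.Finite k ((F.map (glAct g).toLinearMap).map (coeffsAt k T)) :=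
      FiniteDimensional.finiteDimensional_submodule _
    simpa using h4.fintype_card_le_finrank
  · rw [Set.mem_ofPred_eq, hN]
    have : (Matrix.of fun i j => p (coeffsAt k T (glAct g₀ (v j))) i) = 1 := by
      ext i j
      have h1 := LinearMap.congr_fun hp (Pi.single j 1)
      rw [LinearMap.comp_apply, Fintype.linearCombination_apply_single, one_smul] at h1
      rw [Matrix.of_apply, h1, LinearMap.id_apply, Matrix.one_apply, Pi.single_apply]
    rw [this, Matrix.det_one]
    exact one_ne_zero

end Zariski

/-! ### Strata with prescribed leading exponents in one degree -/

section Strata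

variable {k : Type*} [Field k] {n : ℕ}

attribute [local instance] zariskiGL

/-- The exponents of degree `e` that are at least `δ`. -/
noncomputable def upperExponents {σ : Type*} [Fintype σ] (ord : MonomialOrder σ) (e : ℕ)
    (δ : σ →₀ ℕ) : Finset (σ →₀ ℕ) :=
  (exponents σ e).filter fun a => ord.toSyn δ ≤ ord.toSyn a

theorem mem_upperExponents {σ : Type*} [Fintype σ] {ord : MonomialOrder σ} {e : ℕ}
    {δ a : σ →₀ ℕ} : a ∈ upperExponents ord e δ ↔
      a ∈ exponents σ e ∧ ord.toSyn δ ≤ ord.toSyn a := by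
  rw [upperExponents, Finset.mem_filter]

/-- A set of exponents of degree `e` is determined by the sizes of its upper parts. -/
theorem eq_of_ncard_inter_upperExponents {σ : Type*} [Fintype σ] {ord : MonomialOrder σ} {e : ℕ}
    {A B : Set (σ →₀ ℕ)} (hA : A ⊆ exponents σ e) (hB : B ⊆ exponents σ e)
    (h : ∀ δ ∈ exponents σ e,
      (A ∩ upperExponents ord e δ).ncard = (B ∩ upperExponents ord e δ).ncard) : A = B := by
  classical
  have key : ∀ {A B : Set (σ →₀ ℕ)}, A ⊆ exponents σ e → B ⊆ exponents σ e →
      ∀ δ, δ ∈ A → δ ∉ B →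
      (∀ b, (b ∈ A ∧ b ∉ B) ∨ (b ∈ B ∧ b ∉ A) → ord.toSyn b ≤ ord.toSyn δ) →
      (B ∩ upperExponents ord e δ).ncard < (A ∩ upperExponents ord e δ).ncard := by
    intro A B hA hB δ hδA hδB hmax
    refine Set.ncard_lt_ncard ?_ ((Finset.finite_toSet _).subset Set.inter_subset_right)
    refine (Set.ssubset_iff_of_subset ?_).2 ⟨δ, ⟨hδA, ?_⟩, fun h => hδB h.1⟩
    · rintro b ⟨hb, hbδ⟩
      refine ⟨?_, hbδ⟩
      by_contra hbA
      have h1 := hmax b (Or.inr ⟨hb, hbA⟩)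
      have h2 := (mem_upperExponents.1 hbδ).2
      exact hδB (ord.toSyn.injective (le_antisymm h1 h2) ▸ hb)
    · exact mem_upperExponents.2 ⟨hA hδA, le_rfl⟩
  by_contra hne
  have hS : ((exponents σ e).filter fun b => (b ∈ A ∧ b ∉ B) ∨ (b ∈ B ∧ b ∉ A)).Nonempty := by
    by_contra hemp
    rw [Finset.not_nonempty_iff_eq_empty, Finset.filter_eq_empty_iff] at hemp
    apply hne
    ext b
    constructor
    · intro hb
      by_contra hb'
      exact hemp (hA hb) (Or.inl ⟨hb, hb'⟩)
    · intro hb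
      by_contra hb'
      exact hemp (hB hb) (Or.inr ⟨hb, hb'⟩)
  -- At the largest element of the symmetric difference the two counts differ by exactly that
  -- element.
  obtain ⟨δ, hδ, hmax⟩ := Finset.exists_max_image _ ord.toSyn hS
  rw [Finset.mem_filter] at hδ
  have hmax' : ∀ b, (b ∈ A ∧ b ∉ B) ∨ (b ∈ B ∧ b ∉ A) → ord.toSyn b ≤ ord.toSyn δ := by
    intro b hb
    refine hmax b (Finset.mem_filter.2 ⟨?_, hb⟩)
    rcases hb with hb | hb
    · exact hA hb.1
    · exact hB hb.1
  rcases hδ.2 with h1 | h1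
  · exact (key hA hB δ h1.1 h1.2 hmax').ne (h δ hδ.1).symm
  · exact (key hB hA δ h1.1 h1.2 fun b hb => hmax' b hb.symm).ne (h δ hδ.1)

/-- The exponents of the initial monomials of the degree `e` part of `g.I`. -/
def movedExponents (ord : MonomialOrder (Fin (n + 1))) (I : Ideal (MvPolynomial (Fin (n + 1)) k))
    (e : ℕ) (g : GL (Fin (n + 1)) k) : Set (Fin (n + 1) →₀ ℕ) :=
  leadingExponents ord (gradedPart (glIdeal g I) e)

variable {ord : MonomialOrder (Fin (n + 1))} {I : Ideal (MvPolynomial (Fin (n + 1)) k)}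

theorem movedExponents_subset (e : ℕ) (g : GL (Fin (n + 1)) k) :
    movedExponents ord I e g ⊆ exponents (Fin (n + 1)) e :=
  leadingExponents_subset_exponents ord (gradedPart_le _ e)

theorem ncard_movedExponents (hI : IsGraded I) (e : ℕ) (g : GL (Fin (n + 1)) k) :
    (movedExponents ord I e g).ncard = Module.finrank k (gradedPart I e) := by
  rw [movedExponents, ← finrank_eq_ncard_leadingExponents ord (gradedPart_le _ e),
    finrank_gradedPart_glIdeal hI]

/-- The exponents of degree `e` above `δ` form an upper set, so they contain the leading exponent of
every homogeneous polynomial meeting them. The count is therefore a rank, which is semicontinuous.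
-/
theorem isOpen_le_ncard (hI : IsGraded I) (e : ℕ) (δ : Fin (n + 1) →₀ ℕ) (r : ℕ) :
    IsOpen {g : GL (Fin (n + 1)) k |
      r ≤ (movedExponents ord I e g ∩ upperExponents ord e δ).ncard} := by
  have h := isOpen_le_finrank_map_coeffsAt (gradedPart I e) (upperExponents ord e δ) r
  convert h using 3 with g
  rw [← gradedPart_glIdeal hI, finrank_map_coeffsAt ord]
  · rfl
  · intro f hf a ha hfa
    have hf0 : f ≠ 0 := by rintro rfl; simp at hfa
    exact mem_upperExponents.2 ⟨leadingExponents_subset_exponents ord (gradedPart_le _ e)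
      ⟨f, hf, hf0, rfl⟩, (mem_upperExponents.1 ha).2.trans (ord.le_degree (mem_support_iff.2 hfa))⟩

theorem isLocallyClosed_movedExponents_eq (hI : IsGraded I) (e : ℕ)
    (A : Set (Fin (n + 1) →₀ ℕ)) :
    IsLocallyClosed {g : GL (Fin (n + 1)) k | movedExponents ord I e g = A} := by
  by_cases hA : A ⊆ exponents (Fin (n + 1)) e
  · let c : (Fin (n + 1) →₀ ℕ) → ℕ := fun δ => (A ∩ upperExponents ord e δ).ncard
    let U : Set (GL (Fin (n + 1)) k) := ⋂ δ ∈ exponents (Fin (n + 1)) e,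
      {g | c δ ≤ (movedExponents ord I e g ∩ upperExponents ord e δ).ncard}
    let V : Set (GL (Fin (n + 1)) k) := ⋃ δ ∈ exponents (Fin (n + 1)) e,
      {g | c δ + 1 ≤ (movedExponents ord I e g ∩ upperExponents ord e δ).ncard}
    have hU : IsOpen U := isOpen_biInter_finset fun δ _ => isOpen_le_ncard hI e δ _
    have hV : IsOpen V := isOpen_biUnion fun δ _ => isOpen_le_ncard hI e δ _
    have heq : {g : GL (Fin (n + 1)) k | movedExponents ord I e g = A} = U ∩ Vᶜ := by
      ext g
      simp only [U, V, Set.mem_ofPred_eq, Set.mem_inter_iff, Set.mem_iInter, Set.mem_compl_iff,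
        Set.mem_iUnion, not_exists, not_le]
      constructor
      · rintro rfl
        exact ⟨fun δ _ => le_rfl, fun δ _ => Nat.lt_succ_self _⟩
      · rintro ⟨h1, h2⟩
        refine eq_of_ncard_inter_upperExponents (ord := ord) (movedExponents_subset e g) hA
          fun δ hδ => ?_
        exact le_antisymm (Nat.lt_succ_iff.1 (h2 δ hδ)) (h1 δ hδ)
    rw [heq]
    exact hU.isLocallyClosed.inter hV.isClosed_compl.isLocallyClosed
  · have : {g : GL (Fin (n + 1)) k | movedExponents ord I e g = A} = ∅ := by
      ext g
      simp only [Set.mem_ofPred_eq, Set.mem_empty_iff_false, iff_false]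
      rintro rfl
      exact hA (movedExponents_subset e g)
    rw [this]
    exact isOpen_empty.isLocallyClosed

theorem isLocallyClosed_biInter {X ι : Type*} [TopologicalSpace X] (s : Finset ι) {U : ι → Set X}
    (hU : ∀ i ∈ s, IsLocallyClosed (U i)) : IsLocallyClosed (⋂ i ∈ s, U i) := by
  classical
  induction s using Finset.induction_on with
  | empty => simpa using isOpen_univ.isLocallyClosed
  | insert a s _ ih =>
    rw [Finset.set_biInter_insert]
    exact (hU a (Finset.mem_insert_self a s)).inter
      (ih fun i hi => hU i (Finset.mem_insert_of_mem hi))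

/-- The generic initial exponents of degree `e`. -/
theorem exists_generic_movedExponents [Infinite k] (hI : IsGraded I) (e : ℕ) :
    ∃ g₀ : GL (Fin (n + 1)) k,
      IsOpen {g | movedExponents ord I e g = movedExponents ord I e g₀} ∧
      ∀ g, ∀ δ ∈ exponents (Fin (n + 1)) e,
        (movedExponents ord I e g ∩ upperExponents ord e δ).ncard ≤
          (movedExponents ord I e g₀ ∩ upperExponents ord e δ).ncard := by
  let ρ : (Fin (n + 1) →₀ ℕ) → GL (Fin (n + 1)) k → ℕ := fun δ g =>
    (movedExponents ord I e g ∩ upperExponents ord e δ).ncard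
  have hmax : ∀ δ, ∃ g, ∀ g', ρ δ g' ≤ ρ δ g := by
    intro δ
    have hbdd : BddAbove (Set.range (ρ δ)) := by
      refine ⟨(upperExponents ord e δ).card, ?_⟩
      rintro _ ⟨g, rfl⟩
      rw [← Set.ncard_coe_finset]
      exact Set.ncard_le_ncard Set.inter_subset_right (Finset.finite_toSet _)
    obtain ⟨g, hg⟩ := Nat.sSup_mem (Set.range_nonempty (ρ δ)) hbdd
    refine ⟨g, fun g' => ?_⟩
    rw [hg]
    exact le_csSup hbdd (Set.mem_range_self g')
  choose γ hγ using hmax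
  -- Each count attains its maximum on a nonempty open set; by irreducibility these finitely many
  -- sets have a common point.
  obtain ⟨hO, g₀, hg₀⟩ := nonempty_biInter_of_isOpen (exponents (Fin (n + 1)) e)
    (U := fun δ => {g | ρ δ (γ δ) ≤ ρ δ g}) (fun δ _ => isOpen_le_ncard hI e δ _)
    fun δ _ => ⟨γ δ, hγ δ (γ δ)⟩
  simp only [Set.mem_iInter, Set.mem_ofPred_eq] at hg₀
  refine ⟨g₀, ?_, fun g δ hδ => (hγ δ g).trans (hg₀ δ hδ)⟩
  convert hO using 1
  ext g
  simp only [Set.mem_iInter, Set.mem_ofPred_eq]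
  constructor
  · intro h δ hδ
    have : ρ δ g = ρ δ g₀ := by simp only [ρ, h]
    rw [this]; exact hg₀ δ hδ
  · intro h
    refine eq_of_ncard_inter_upperExponents (ord := ord) (movedExponents_subset e g)
      (movedExponents_subset e g₀) fun δ hδ => ?_
    exact le_antisymm ((hγ δ g).trans (hg₀ δ hδ)) ((hγ δ g₀).trans (h δ hδ))

end Strata

/-! ### Schubert indices as sets of exponents -/

section SchubertIndices

variable {k : Type*} [Field k] {n : ℕ} {ord : MonomialOrder (Fin (n + 1))} {m d : ℕ}

namespace SchubertIndex

theorem strictAnti (α : SchubertIndex ord m d) : StrictAnti fun i => ord.toSyn (α.exps i) :=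
  fun i j h => α.decreasing i j h

theorem exps_injective (α : SchubertIndex ord m d) : Function.Injective α.exps :=
  fun _ _ h => α.strictAnti.injective (congrArg ord.toSyn h)

theorem ncard_range (α : SchubertIndex ord m d) : (Set.range α.exps).ncard = d := by
  rw [← Set.image_univ, Set.ncard_image_of_injective _ α.exps_injective, Set.ncard_univ,
    Nat.card_eq_fintype_card, Fintype.card_fin]

theorem exps_inj {α β : SchubertIndex ord m d} (h : α.exps = β.exps) : α = β := by
  cases α; cases β; cases h; rfl

theorem range_inj {α β : SchubertIndex ord m d} (h : Set.range α.exps = Set.range β.exps) :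
    α = β := by
  apply exps_inj
  have h1 : (fun i => ord.toSyn (α.exps i)) = fun i => ord.toSyn (β.exps i) := by
    rw [← StrictAnti.range_inj α.strictAnti β.strictAnti]
    have h2 := congrArg (fun s => ord.toSyn '' s) h
    simpa only [← Set.range_comp, Function.comp_def] using h2
  funext i
  exact ord.toSyn.injective (congrFun h1 i)

theorem finite : Finite (SchubertIndex ord m d) := by
  let φ : SchubertIndex ord m d → Fin d → exponents (Fin (n + 1)) m :=
    fun α i => ⟨α.exps i, mem_exponents.2 (α.degree_eq i)⟩
  refine Finite.of_injective φ fun α β h => exps_inj ?_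
  funext i
  exact congrArg Subtype.val (congrFun h i)

theorem exists_range_eq {A : Set (Fin (n + 1) →₀ ℕ)} (hA : A ⊆ exponents (Fin (n + 1)) m)
    (hd : A.ncard = d) : ∃ α : SchubertIndex ord m d, Set.range α.exps = A := by
  classical
  have hfin : A.Finite := (Finset.finite_toSet _).subset hA
  let s : Finset ord.syn := hfin.toFinset.image ord.toSyn
  have hs : s.card = d := by
    rw [Finset.card_image_of_injective _ ord.toSyn.injective, ← hd, Set.ncard_eq_toFinset_card A hfin]
  let φ := s.orderEmbOfFin hs
  have hφ : ∀ i, ord.toSyn.symm (φ i) ∈ A := by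
    intro i
    obtain ⟨a, ha, hai⟩ := Finset.mem_image.1 (s.orderEmbOfFin_mem hs i)
    rw [← hai, AddEquiv.symm_apply_apply]
    exact hfin.mem_toFinset.1 ha
  refine ⟨⟨fun i => ord.toSyn.symm (φ i.rev), fun i => mem_exponents.1 (hA (hφ _)), ?_⟩, ?_⟩
  · intro i j hij
    simp only [AddEquiv.apply_symm_apply]
    exact φ.strictMono (Fin.rev_lt_rev.2 hij)
  · refine subset_antisymm ?_ ?_
    · rintro _ ⟨i, rfl⟩; exact hφ _
    · intro a ha
      have : ord.toSyn a ∈ Set.range φ := by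
        rw [s.range_orderEmbOfFin hs]
        exact Finset.mem_image_of_mem _ (hfin.mem_toFinset.2 ha)
      obtain ⟨i, hi⟩ := this
      exact ⟨i.rev, by simp [hi]⟩

/-- If `β(i) ≺ α(i)`, then at `δ = α(i)` the entries of `α` up to `i` all count, whereas only
entries of `β` strictly before `i` can. -/
theorem le_of_ncard_inter_le {α β : SchubertIndex ord m d}
    (h : ∀ δ ∈ exponents (Fin (n + 1)) m,
      (Set.range α.exps ∩ upperExponents ord m δ).ncard ≤
        (Set.range β.exps ∩ upperExponents ord m δ).ncard) : α.le β := by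
  intro i
  by_contra hlt
  rw [not_le] at hlt
  have h1 := h (α.exps i) (mem_exponents.2 (α.degree_eq i))
  have h2 : α.exps '' Set.Iic i ⊆ Set.range α.exps ∩ upperExponents ord m (α.exps i) := by
    rintro _ ⟨j, hj, rfl⟩
    exact ⟨⟨j, rfl⟩, mem_upperExponents.2
      ⟨mem_exponents.2 (α.degree_eq j), α.strictAnti.antitone hj⟩⟩
  have h3 : Set.range β.exps ∩ upperExponents ord m (α.exps i) ⊆ β.exps '' Set.Iio i := by
    rintro _ ⟨⟨j, rfl⟩, hj⟩
    refine ⟨j, ?_, rfl⟩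
    by_contra hji
    have h4 := β.strictAnti.antitone (not_lt.1 hji)
    exact absurd ((mem_upperExponents.1 hj).2.trans h4) (not_le.2 hlt)
  have h4 := Set.ncard_le_ncard h2 ((Finset.finite_toSet _).subset Set.inter_subset_right)
  have h5 := Set.ncard_le_ncard h3 ((Set.toFinite _).image _)
  rw [Set.ncard_image_of_injective _ α.exps_injective] at h4
  rw [Set.ncard_image_of_injective _ β.exps_injective] at h5
  have h6 : (Set.Iio i).ncard < (Set.Iic i).ncard :=
    Set.ncard_lt_ncard (Set.Iio_ssubset_Iic_self) (Set.toFinite _)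
  omega

theorem span_monomials (α : SchubertIndex ord m d) :
    Submodule.span k (α.monomials k) = restrictSupport k (Set.range α.exps) := by
  rw [restrictSupport_eq_span, ← Set.range_comp]
  rfl

end SchubertIndex

theorem mem_schubertPiece_iff {I : Ideal (MvPolynomial (Fin (n + 1)) k)} (hI : IsGraded I)
    (hd : Module.finrank k (gradedPart I m) = d) (α : SchubertIndex ord m d)
    (g : GL (Fin (n + 1)) k) :
    g ∈ schubertPiece I α ↔ movedExponents ord I m g = Set.range α.exps := by
  have h : initialSubspace ord (degreePart (glIdeal g I) m) =
      restrictSupport k (movedExponents ord I m g) :=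
    initialSubspace_eq_restrictSupport ord _
  constructor
  · rintro ⟨-, -, h1⟩
    rw [h, SchubertIndex.span_monomials] at h1
    exact restrictSupport_injective h1
  · intro h1
    refine ⟨gradedPart_le _ m, ?_, ?_⟩
    · rw [← hd]; exact finrank_gradedPart_glIdeal hI g m
    · rw [h, h1, SchubertIndex.span_monomials]

end SchubertIndices

/-! ### Initial ideals of translates and their saturations -/

section InitialStrata

variable {k : Type*} [Field k] {n : ℕ} (ord : MonomialOrder (Fin (n + 1)))
  {I : Ideal (MvPolynomial (Fin (n + 1)) k)}

theorem gradedPart_initialIdeal_glIdeal (hI : IsGraded I) (g : GL (Fin (n + 1)) k) (e : ℕ) :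
    gradedPart (initialIdeal ord (glIdeal g I)) e =
      restrictSupport k (movedExponents ord I e g) :=
  gradedPart_initialIdeal ord (hI.glIdeal g) e

/-- The initial ideals of the translates of an ideal are determined in bounded degrees. -/
theorem exists_initialIdeal_glIdeal_eq_iff [Infinite k] (hI : IsGraded I) :
    ∃ M : ℕ, ∀ g g' : GL (Fin (n + 1)) k,
      initialIdeal ord (glIdeal g I) = initialIdeal ord (glIdeal g' I) ↔
        ∀ e ∈ Finset.range (M + 1), movedExponents ord I e g = movedExponents ord I e g' := by
  -- With the actual Hilbert function of `I` as `Q`, all translates satisfy the dimension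
  -- hypothesis, so their initial ideals are generated in degrees at most `M`.
  obtain ⟨M, hM⟩ := exists_uniform_bound (k := k) (n + 1)
    fun e => Module.finrank k (gradedPart I e)
  refine ⟨M, fun g g' => ⟨fun h e _ => ?_, fun h => ?_⟩⟩
  · apply restrictSupport_injective (k := k)
    rw [← gradedPart_initialIdeal_glIdeal ord hI, ← gradedPart_initialIdeal_glIdeal ord hI, h]
  · have hlow : ∀ e, e ≤ M → gradedPart (initialIdeal ord (glIdeal g I)) e =
        gradedPart (initialIdeal ord (glIdeal g' I)) e := by
      intro e he
      rw [gradedPart_initialIdeal_glIdeal ord hI, gradedPart_initialIdeal_glIdeal ord hI,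
        h e (Finset.mem_range.2 (by omega))]
    have hgen : ∀ (g : GL (Fin (n + 1)) k) e, M ≤ e →
        ∀ f ∈ gradedPart (initialIdeal ord (glIdeal g I)) (e + 1),
        ∃ b : Fin (n + 1) → MvPolynomial (Fin (n + 1)) k,
          (∀ i, b i ∈ gradedPart (initialIdeal ord (glIdeal g I)) e) ∧ f = ∑ i, X i * b i :=
      fun g e he => (gradedPart_sat_initialIdeal ord hM (hI.glIdeal g)
        (fun e _ => by rw [finrank_gradedPart_glIdeal hI]) he).2
    have hstep : ∀ (g g' : GL (Fin (n + 1)) k) e, M ≤ e →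
        gradedPart (initialIdeal ord (glIdeal g I)) e ≤
          gradedPart (initialIdeal ord (glIdeal g' I)) e →
        gradedPart (initialIdeal ord (glIdeal g I)) (e + 1) ≤
          gradedPart (initialIdeal ord (glIdeal g' I)) (e + 1) := by
      intro g g' e he hle f hf
      obtain ⟨b, hb, hfb⟩ := hgen g e he f hf
      refine ⟨?_, hf.2⟩
      change f ∈ initialIdeal ord (glIdeal g' I)
      rw [hfb]
      exact Ideal.sum_mem _ fun i _ => Ideal.mul_mem_left _ _ (hle (hb i)).1
    refine (isGraded_initialIdeal ord _).ext (isGraded_initialIdeal ord _) fun e => ?_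
    rcases le_total e M with he | he
    · exact hlow e he
    · induction e, he using Nat.le_induction with
      | base => exact hlow M le_rfl
      | succ e he ih => exact le_antisymm (hstep g g' e he ih.le) (hstep g' g e he ih.ge)

theorem finite_range_initialIdeal_glIdeal [Infinite k] (hI : IsGraded I) :
    (Set.range fun g : GL (Fin (n + 1)) k => initialIdeal ord (glIdeal g I)).Finite := by
  classical
  obtain ⟨M, hM⟩ := exists_initialIdeal_glIdeal_eq_iff ord hI
  let K : GL (Fin (n + 1)) k → Ideal (MvPolynomial (Fin (n + 1)) k) :=
    fun g => initialIdeal ord (glIdeal g I)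
  -- The exponents in degrees at most `M`, recorded in a finite type through which the initial ideal
  -- factors.
  let Φ : GL (Fin (n + 1)) k →
      (i : Finset.range (M + 1)) → Set (exponents (Fin (n + 1)) i.1) :=
    fun g i => {a | a.1 ∈ movedExponents ord I i.1 g}
  have hΦ : Function.FactorsThrough K Φ := by
    intro g g' h
    refine (hM g g').2 fun e he => ?_
    have h1 := congrFun h ⟨e, he⟩
    ext a
    constructor
    · intro ha
      have : (⟨a, movedExponents_subset e g ha⟩ : exponents (Fin (n + 1)) e) ∈ Φ g ⟨e, he⟩ := ha
      rw [h1] at this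
      exact this
    · intro ha
      have : (⟨a, movedExponents_subset e g' ha⟩ : exponents (Fin (n + 1)) e) ∈ Φ g' ⟨e, he⟩ := ha
      rw [← h1] at this
      exact this
  refine (Set.finite_range (Function.extend Φ K fun _ => ⊥)).subset ?_
  rintro _ ⟨g, rfl⟩
  exact ⟨Φ g, hΦ.extend_apply _ g⟩

attribute [local instance] zariskiGL

theorem isLocallyClosed_initialPiece [Infinite k] (hI : IsGraded I)
    (K : Ideal (MvPolynomial (Fin (n + 1)) k)) : IsLocallyClosed (initialPiece ord I K) := by
  obtain ⟨M, hM⟩ := exists_initialIdeal_glIdeal_eq_iff ord hI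
  rcases (initialPiece ord I K).eq_empty_or_nonempty with h | ⟨g₀, rfl⟩
  · rw [h]; exact isOpen_empty.isLocallyClosed
  · have : initialPiece ord I (initialIdeal ord (glIdeal g₀ I)) =
        ⋂ e ∈ Finset.range (M + 1),
          {g | movedExponents ord I e g = movedExponents ord I e g₀} := by
      ext g
      simp only [Set.mem_iInter]
      exact hM g g₀
    rw [this]
    exact isLocallyClosed_biInter _ fun e _ => isLocallyClosed_movedExponents_eq hI e _

theorem existsUnique_generic_initialIdeal [Infinite k] (hI : IsGraded I) :
    ∃! K : Ideal (MvPolynomial (Fin (n + 1)) k),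
      IsOpen (initialPiece ord I K) ∧ Dense (initialPiece ord I K) := by
  obtain ⟨M, hM⟩ := exists_initialIdeal_glIdeal_eq_iff ord hI
  choose γ hγ using fun e => exists_generic_movedExponents (ord := ord) hI e
  obtain ⟨hO, g₀, hg₀⟩ := nonempty_biInter_of_isOpen (Finset.range (M + 1))
    (U := fun e => {g | movedExponents ord I e g = movedExponents ord I e (γ e)})
    (fun e _ => (hγ e).1) fun e _ => ⟨γ e, rfl⟩
  simp only [Set.mem_iInter, Set.mem_ofPred_eq] at hg₀
  have heq : initialPiece ord I (initialIdeal ord (glIdeal g₀ I)) =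
      ⋂ e ∈ Finset.range (M + 1), {g | movedExponents ord I e g = movedExponents ord I e (γ e)} := by
    ext g
    simp only [Set.mem_iInter]
    refine (hM g g₀).trans (forall₂_congr fun e he => ?_)
    rw [hg₀ e he]; rfl
  have hopen : IsOpen (initialPiece ord I (initialIdeal ord (glIdeal g₀ I))) := heq ▸ hO
  refine ⟨_, ⟨hopen, dense_of_isOpen hopen ⟨g₀, rfl⟩⟩, ?_⟩
  rintro K ⟨hK, hKd⟩
  obtain ⟨g, hg, hg'⟩ := nonempty_inter_of_isOpen hK hopen hKd.nonempty ⟨g₀, rfl⟩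
  exact hg.symm.trans hg'

theorem sat_mono {J K : Ideal (MvPolynomial (Fin (n + 1)) k)} (h : J ≤ K) : sat J ≤ sat K := by
  intro f hf
  obtain ⟨l, hl⟩ := mem_sat.1 hf
  exact mem_sat.2 ⟨l, fun a ha => h (hl a ha)⟩

/-- Multiplying by a monomial of degree `m` moves every homogeneous component into degrees where the
comparison holds. -/
theorem IsGraded.le_sat_of_gradedPart_le {T N : Ideal (MvPolynomial (Fin (n + 1)) k)}
    (hT : IsGraded T) {m : ℕ} (h : ∀ e, m ≤ e → gradedPart T e ≤ gradedPart N e) :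
    T ≤ _root_.sat N := by
  intro f hf
  refine mem_sat.2 ⟨m, fun a ha => ?_⟩
  rw [← sum_homogeneousComponent f, Finset.sum_mul]
  refine Ideal.sum_mem _ fun i _ => ?_
  rw [← homogeneousComponent_mul_monomial]
  exact (h (i + a.degree) (by omega) (hT.component_mem (T.mul_mem_right _ hf) _)).1

/-- In degrees at least the Gotzmann number, the initial ideal of `g.I` is saturated, and its
saturation is generated in any such degree. -/
theorem gradedPart_sat_initialIdeal_glIdeal [Infinite k] {P : Polynomial ℚ}
    {m : ℕ} (hm : gotzmannNumber k n P ≤ m) (hI : IsSaturatedHomogeneous I)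
    (hP : HasHilbertPolynomial I P) (g : GL (Fin (n + 1)) k) :
    IsRegularIdeal (sat (initialIdeal ord (glIdeal g I))) m ∧
    gradedPart (sat (initialIdeal ord (glIdeal g I))) m =
      restrictSupport k (movedExponents ord I m g) := by
  have hI' := isSaturatedHomogeneous_iff.1 hI
  have hK := isGraded_initialIdeal ord (glIdeal g I)
  have hfin : ∀ e, Module.finrank k (gradedPart (initialIdeal ord (glIdeal g I)) e) =
      Module.finrank k (gradedPart I e) := fun e => by
    rw [finrank_gradedPart_initialIdeal ord (hI'.1.glIdeal g), finrank_gradedPart_glIdeal hI'.1]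
  have hPT : HasHilbertPolynomial (sat (initialIdeal ord (glIdeal g I))) P := by
    refine hP.of_eventually_finrank ?_
    filter_upwards [gradedPart_sat_eventually hK] with e he
    rw [he, hfin]
  have hreg := isRegularIdeal_of_gotzmannNumber_le hm
    (isSaturatedHomogeneous_iff.2 ⟨hK.sat, isSat_sat _⟩) hPT
  refine ⟨hreg, ?_⟩
  rw [← gradedPart_initialIdeal_glIdeal ord hI'.1]
  refine (Submodule.eq_of_le_of_finrank_eq (gradedPart_mono (le_sat _) m) ?_).symm
  rw [hfin]
  -- The saturated initial ideal and `I` are both `m`-regular with Hilbert polynomial `P`, so both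
  -- Hilbert functions equal P(m) in degree `m`, and the inclusion of in(g.I)_m in the saturation is
  -- an equality.
  have h1 := hreg.hilbertFunction_eq hPT
  have h2 := (isRegularIdeal_of_gotzmannNumber_le hm hI hP).hilbertFunction_eq hP
  rw [← h2] at h1
  have h3 := hilbertFunction_add_finrank_gradedPart I m
  have h4 := hilbertFunction_add_finrank_gradedPart (sat (initialIdeal ord (glIdeal g I))) m
  have h5 : hilbertFunction (sat (initialIdeal ord (glIdeal g I))) m = hilbertFunction I m := by
    exact_mod_cast h1
  omega

/-- The Schubert pieces are described by the saturated initial ideal. -/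
theorem mem_schubertPiece_iff_sat_initialIdeal [Infinite k] {P : Polynomial ℚ}
    {m d : ℕ} (hm : gotzmannNumber k n P ≤ m) (hI : IsSaturatedHomogeneous I)
    (hP : HasHilbertPolynomial I P) (hd : Module.finrank k (gradedPart I m) = d)
    (α : SchubertIndex ord m d) (g : GL (Fin (n + 1)) k) :
    g ∈ schubertPiece I α ↔ sat (initialIdeal ord (glIdeal g I)) = α.ideal k := by
  have hI' := isSaturatedHomogeneous_iff.1 hI
  obtain ⟨hreg, hTm⟩ := gradedPart_sat_initialIdeal_glIdeal ord hm hI hP g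
  rw [mem_schubertPiece_iff hI'.1 hd]
  have hideal : α.ideal k = sat (Ideal.span (α.monomials k)) := rfl
  have hmon : ∀ i, monomial (α.exps i) (1 : k) ∈ Ideal.span (α.monomials k) := fun i =>
    Ideal.subset_span ⟨i, rfl⟩
  rw [hideal]
  constructor
  · intro h
    rw [h] at hTm
    refine le_antisymm ?_ ?_
    · refine (isGraded_initialIdeal ord _).sat.le_sat_of_gradedPart_le (m := m) fun e he => ?_
      induction e, he using Nat.le_induction with
      | base =>
        intro f hf
        refine ⟨?_, hf.2⟩
        rw [hTm, restrictSupport_eq_span] at hf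
        have hle : Submodule.span k ((fun a => monomial a (1 : k)) '' Set.range α.exps) ≤
            (Ideal.span (α.monomials k)).restrictScalars k := by
          refine Submodule.span_le.2 ?_
          rintro _ ⟨_, ⟨i, rfl⟩, rfl⟩
          exact hmon i
        exact hle hf
      | succ e he ih =>
        intro f hf
        -- Regularity makes the degree `m` part generate everything above it; agreement in high
        -- degrees suffices for the saturations.
        obtain ⟨b, hb, hfb⟩ := hreg.exists_eq_sum he hf
        refine ⟨?_, hf.2⟩
        change f ∈ Ideal.span (α.monomials k)
        rw [hfb]
        exact Ideal.sum_mem _ fun i _ => Ideal.mul_mem_left _ _ (ih (hb i)).1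
    · refine sat_mono (Ideal.span_le.2 ?_)
      rintro _ ⟨i, rfl⟩
      have : monomial (α.exps i) (1 : k) ∈
          gradedPart (initialIdeal ord (glIdeal g I)) m := by
        rw [gradedPart_initialIdeal_glIdeal ord hI'.1, h, monomial_mem_restrictSupport]
        exact Or.inl ⟨i, rfl⟩
      exact this.1
  · intro h
    symm
    -- The monomials of `α` lie in the degree `m` part of the saturation, giving one inclusion; both
    -- sets have `d` elements.
    refine Set.eq_of_subset_of_ncard_le ?_ ?_
      ((Finset.finite_toSet _).subset (movedExponents_subset m g))
    · rintro _ ⟨i, rfl⟩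
      have : monomial (α.exps i) (1 : k) ∈
          gradedPart (sat (initialIdeal ord (glIdeal g I))) m :=
        ⟨h ▸ le_sat _ (hmon i), isHomogeneous_monomial _ (α.degree_eq i)⟩
      rw [hTm, monomial_mem_restrictSupport] at this
      exact this.resolve_right one_ne_zero
    · rw [ncard_movedExponents hI'.1, hd, α.ncard_range]

end InitialStrata

/-! ### The theorem -/

theorem mainTheorem4 {k : Type*} [Field k] [IsAlgClosed k] [CharZero k] (n : ℕ)
    (ord : MonomialOrder (Fin (n + 1)))
    (I : Ideal (MvPolynomial (Fin (n + 1)) k)) (hI : IsSaturatedHomogeneous I)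
    (P : Polynomial ℚ) (hP : HasHilbertPolynomial I P) :
    -- the decomposition induced by the Schubert cells in degree `m`
    (∀ m : ℕ, gotzmannNumber k n P ≤ m →
      ∃ d : ℕ, (d : ℚ) = ((n + m).choose m : ℚ) - P.eval (m : ℚ) ∧
        -- a finite decomposition into locally closed pieces
        Finite (SchubertIndex ord m d) ∧
        (∀ g : GL (Fin (n + 1)) k, ∃! α : SchubertIndex ord m d, g ∈ schubertPiece I α) ∧
        (∀ α : SchubertIndex ord m d,
          @IsLocallyClosed _ (zariskiGL k n) (schubertPiece I α)) ∧
        -- the greatest index of a nonempty piece exists, and its piece is open and dense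
        (∃ α : SchubertIndex ord m d, (schubertPiece I α).Nonempty ∧
          (∀ β : SchubertIndex ord m d, (schubertPiece I β).Nonempty → β.le α) ∧
          @IsOpen _ (zariskiGL k n) (schubertPiece I α) ∧
          @Dense _ (zariskiGL k n) (schubertPiece I α)) ∧
        -- the pieces are distinguished by the (saturated) initial ideal, which is `I_α` on `C''_α`
        (∀ g g' : GL (Fin (n + 1)) k,
          (∃ α : SchubertIndex ord m d, g ∈ schubertPiece I α ∧ g' ∈ schubertPiece I α) ↔
            saturationIdeal (initialIdeal ord (glIdeal g I)) =
              saturationIdeal (initialIdeal ord (glIdeal g' I))) ∧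
        (∀ (α : SchubertIndex ord m d) (g : GL (Fin (n + 1)) k),
          g ∈ schubertPiece I α ↔
            saturationIdeal (initialIdeal ord (glIdeal g I)) = α.ideal k) ∧
        -- the pieces are `B`-invariant
        (∀ (α : SchubertIndex ord m d), ∀ b ∈ standardBorel k ord, ∀ g ∈ schubertPiece I α,
          b * g ∈ schubertPiece I α)) ∧
    -- the decomposition according to the initial ideal itself, and the generic initial ideal
    (Set.range fun g : GL (Fin (n + 1)) k => initialIdeal ord (glIdeal g I)).Finite ∧
    (∀ K : Ideal (MvPolynomial (Fin (n + 1)) k),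
      @IsLocallyClosed _ (zariskiGL k n) (initialPiece ord I K)) ∧
    (∀ K : Ideal (MvPolynomial (Fin (n + 1)) k), ∀ b ∈ standardBorel k ord, ∀ g ∈ initialPiece ord I K,
      b * g ∈ initialPiece ord I K) ∧
    (∃! K : Ideal (MvPolynomial (Fin (n + 1)) k),
      @IsOpen _ (zariskiGL k n) (initialPiece ord I K) ∧
      @Dense _ (zariskiGL k n) (initialPiece ord I K)) := by
  have hI' := isSaturatedHomogeneous_iff.1 hI
  refine ⟨fun m hm => ?_, finite_range_initialIdeal_glIdeal ord hI'.1,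
    isLocallyClosed_initialPiece ord hI'.1, fun K b hb g hg => ?_,
    existsUnique_generic_initialIdeal ord hI'.1⟩
  · have hmem := mem_schubertPiece_iff (k := k) (ord := ord) (m := m) hI'.1 rfl
    have hsat := mem_schubertPiece_iff_sat_initialIdeal ord hm hI hP rfl
    have hexists : ∀ g : GL (Fin (n + 1)) k,
        ∃ α : SchubertIndex ord m (Module.finrank k (gradedPart I m)), g ∈ schubertPiece I α := by
      intro g
      obtain ⟨α, hα⟩ := SchubertIndex.exists_range_eq (ord := ord)
        (movedExponents_subset (ord := ord) (I := I) m g) (ncard_movedExponents hI'.1 m g)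
      exact ⟨α, (hmem α g).2 hα.symm⟩
    -- The number `d` is dim I_m; regularity in degree `m` identifies it with the binomial
    -- coefficient minus P(m).
    refine ⟨Module.finrank k (gradedPart I m), ?_, SchubertIndex.finite, fun g => ?_, fun α => ?_,
      ?_, fun g g' => ?_, hsat, fun α b hb g hg => ?_⟩
    · have h1 := (isRegularIdeal_of_gotzmannNumber_le hm hI hP).hilbertFunction_eq hP
      rw [← h1,
        ← hilbertFunction_add_finrank_gradedPart I m]
      push_cast; ring
    · obtain ⟨α, hα⟩ := hexists g
      refine ⟨α, hα, fun β hβ => SchubertIndex.range_inj ?_⟩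
      rw [← (hmem α g).1 hα, (hmem β g).1 hβ]
    · have : schubertPiece I α = {g | movedExponents ord I m g = Set.range α.exps} :=
        Set.ext (hmem α)
      rw [this]
      exact isLocallyClosed_movedExponents_eq hI'.1 m _
    · obtain ⟨g₀, hopen, hmax⟩ := exists_generic_movedExponents (ord := ord) hI'.1 m
      obtain ⟨α, hα⟩ := hexists g₀
      have heq : schubertPiece I α =
          {g | movedExponents ord I m g = movedExponents ord I m g₀} := by
        rw [(hmem α g₀).1 hα]
        exact Set.ext (hmem α)
      rw [← heq] at hopen
      refine ⟨α, ⟨g₀, hα⟩, ?_, hopen, dense_of_isOpen hopen ⟨g₀, hα⟩⟩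
      rintro β ⟨g, hg⟩
      refine SchubertIndex.le_of_ncard_inter_le fun δ hδ => ?_
      rw [← (hmem α g₀).1 hα, ← (hmem β g).1 hg]
      exact hmax g δ hδ
    · constructor
      · rintro ⟨α, h1, h2⟩
        exact ((hsat α g).1 h1).trans ((hsat α g').1 h2).symm
      · intro h
        obtain ⟨α, hα⟩ := hexists g
        exact ⟨α, hα, (hsat α g').2 (h.symm.trans ((hsat α g).1 hα))⟩
    · rw [hmem] at hg ⊢
      rw [← hg]
      exact leadingExponents_gradedPart_glIdeal_mul hb g hI'.1 m
  · exact (initialIdeal_glIdeal_mul hb g hI'.1).trans hg
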